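/- Let $q,d\ge 1$ be integers and let $\mu$ be Lebesgue measure on $[0,1]$. For $v\in[0,1]$ let $\psi_v(u)=(u-v)_+^{q-1}$, $u\in[0,1]$ (with $x_+^0=1\{x\ge 0\}$), and let $\Psi=\{\psi_v: v\in[0,1]\}\subset L_2(\mu)$. Let $\mathcal F=\mathrm{absconv}(\Psi\otimes\cdots\otimes\Psi)\subset L_2(\mu^{d})$ ($d$ factors) be the $L_2(\mu^d)$-closure of the set of finite sums $$\sum_{v\in V_1\times\cdots\times V_d}\beta_v\prod_{k=1}^d\psi_{v_k}(u_k),\qquad V_k\subset[0,1]\ \text{finite},\quad \sum_{v}|\beta_v|\le 1 .$$ Let $D=\prod_{k=1}^d\partial^q/\partial u_k^q$, taken in the sense of distributions on $(0,1)^d$, let $\mathcal N=\{h\in L_2(\mu^d): Dh=0\}$ be its null space, and for $f\in L_2(\mu^d)$ let the $q$-th order Vitali total variation $\|Df\|_1\in[0,\infty]$ be the total variation of $Df$, that is, the supremum of $\int f\,D\varphi\,d\mu^d$ over all smooth $\varphi$ with compact support in $(0,1)^d$ and $|\varphi|\le 1$ (equal to $\int|Df|\,d\mu^d$ for smooth $f$).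 For $T$ in a metric space let $N(\epsilon,T)$ be the minimal number of balls of radius $\epsilon$ covering $T$ and $\mathcal H(\epsilon,T)=\log N(\epsilon,T)$; $L_2$-metrics are used throughout, and $h(\epsilon)\lesssim g(\epsilon)$ means $\limsup_{\epsilon\downarrow 0}h(\epsilon)/g(\epsilon)\leq C<\infty$, where $C$ may depend on $q$ and $d$ only. Then: 1. $N(\epsilon,\Psi)\lesssim 1/\epsilon$ if $q\ge 2$, and $N(\epsilon,\Psi)\lesssim 1/\epsilon^2$ if $q=1$. 2. $\mathcal H(\epsilon,\mathcal F)\lesssim \epsilon^{-1/q}\,\log^{d-1}(1/\epsilon)\,\log^{1/(2q)}(1/\epsilon)$. 3. The orthogonal projection of $\mathcal F$ onto the orthogonal complement $\mathcal N^{\perp}$ in $L_2(\mu^d)$ is exactly the class $\{f\in\mathcal N^\perp:\ \|Df\|_1\le ((q-1)!)^d\}$. 4. The class $\mathcal G=\{f\in\mathcal N^{\perp}:\ \|Df\|_1\le 1\}$ of functions orthogonal to the null space of $D$ with $q$-th order Vitali total variation at most $1$ also satisfies $\mathcal H(\epsilon,\mathcal G)\lesssim \epsilon^{-1/q}\,\log^{d-1}(1/\epsilon)\,\log^{1/(2q)}(1/\epsilon)$.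 -/

import Mathlib

open MeasureTheory Filter Topology Set
open scoped ENNReal NNReal Distributions

noncomputable section

namespace MARS

/-- The truncated power function `u ↦ (u - v)₊ ^ (q - 1)`, with `x₊ ^ 0` the indicator of
`x ≥ 0`. -/
def truncPow (q : ℕ) (v u : ℝ) : ℝ := if v ≤ u then (u - v) ^ (q - 1) else 0

/-- Lebesgue measure on `[0, 1]`. -/
abbrev unitMeasure : Measure ℝ := volume.restrict (Icc 0 1)

/-- The `d`-fold product of Lebesgue measure on `[0, 1]`. -/
abbrev cubeMeasure (d : ℕ) : Measure (Fin d → ℝ) := Measure.pi fun _ : Fin d => unitMeasure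

/-- The Hilbert space `L²` of the unit cube. -/
abbrev L2Cube (d : ℕ) : Type := Lp ℝ 2 (cubeMeasure d)

/-- The class `Ψ` of truncated power functions `ψ_v`, `v ∈ [0, 1]`, in `L²[0, 1]`. -/
def truncPowClass (q : ℕ) : Set (Lp ℝ 2 unitMeasure) :=
  {f | ∃ v ∈ Icc (0 : ℝ) 1, f =ᵐ[unitMeasure] truncPow q v}

/-- The tensor product `u ↦ ∏ k, ψ_{v k} (u k)`. -/
def tensorPow (q : ℕ) {d : ℕ} (v u : Fin d → ℝ) : ℝ := ∏ k, truncPow q (v k) (u k)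

/-- The absolute convex hull `absconv (Ψ ⊗ ⋯ ⊗ Ψ)` (`d` factors): the `L²`-closure of the set of
finite sums `∑ v ∈ V₁ × ⋯ × V_d, β_v • (ψ_{v₁} ⊗ ⋯ ⊗ ψ_{v_d})` with `∑ |β_v| ≤ 1` and finite
sets `V_k ⊆ [0, 1]`. -/
def absconvTensor (q d : ℕ) : Set (L2Cube d) :=
  closure {f | ∃ (V : Fin d → Finset ℝ) (β : (Fin d → ℝ) → ℝ),
    (∀ k, ∀ t ∈ V k, t ∈ Icc (0 : ℝ) 1) ∧
    ∑ v ∈ Fintype.piFinset V, |β v| ≤ 1 ∧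
    f =ᵐ[cubeMeasure d] fun u => ∑ v ∈ Fintype.piFinset V, β v * tensorPow q v u}

/-- The entropy: the logarithm of the covering number (by balls centred in `T`), with value `⊤`
if no finite covering exists. -/
def entropy {X : Type*} [PseudoEMetricSpace X] (ε : ℝ≥0) (T : Set X) : EReal :=
  ENNReal.log (Metric.coveringNumber ε T : ℝ≥0∞)

/-- The open unit cube. -/
def openCube (d : ℕ) : TopologicalSpace.Opens (Fin d → ℝ) :=
  ⟨Set.pi univ fun _ => Ioo 0 1, isOpen_set_pi finite_univ fun _ _ => isOpen_Ioo⟩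

/-- The partial derivative in the `k`-th coordinate. -/
def partialDeriv {d : ℕ} (k : Fin d) (φ : (Fin d → ℝ) → ℝ) : (Fin d → ℝ) → ℝ :=
  fun u => lineDeriv ℝ φ u (Pi.single k 1)

/-- The differential operator `D = ∏ k, ∂^q / ∂u_k^q`. -/
def mixedDeriv (q d : ℕ) (φ : (Fin d → ℝ) → ℝ) : (Fin d → ℝ) → ℝ :=
  (List.finRange d).foldr (fun k g => (partialDeriv k)^[q] g) φ

lemma contDiff_partialDeriv {d : ℕ} (k : Fin d) {φ : (Fin d → ℝ) → ℝ}
    (h : ContDiff ℝ (⊤ : ℕ∞) φ) : ContDiff ℝ (⊤ : ℕ∞) (partialDeriv k φ) := by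
  have e : partialDeriv k φ = fun u => fderiv ℝ φ u (Pi.single k 1) := by
    funext u
    exact ((h.differentiable (by simp)) u).lineDeriv_eq_fderiv
  rw [e]
  exact (h.fderiv_right (m := (⊤ : ℕ∞)) (by simp)).clm_apply contDiff_const

lemma contDiff_mixedDeriv (q d : ℕ) {φ : (Fin d → ℝ) → ℝ} (h : ContDiff ℝ (⊤ : ℕ∞) φ) :
    ContDiff ℝ (⊤ : ℕ∞) (mixedDeriv q d φ) := by
  unfold mixedDeriv
  induction List.finRange d with
  | nil => exact h
  | cons k l ih =>
    rw [List.foldr_cons]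
    have key : ∀ (n : ℕ) (g : (Fin d → ℝ) → ℝ), ContDiff ℝ (⊤ : ℕ∞) g →
        ContDiff ℝ (⊤ : ℕ∞) ((partialDeriv k)^[n] g) := by
      intro n
      induction n with
      | zero => intro g hg; exact hg
      | succ n ihn => intro g hg; exact ihn _ (contDiff_partialDeriv k hg)
    exact key q _ ih

lemma integrable_mul_mixedDeriv (q : ℕ) {d : ℕ} (f : L2Cube d) (φ : 𝓓(openCube d, ℝ)) :
    Integrable (fun u => f u * mixedDeriv q d φ u) (cubeMeasure d) := by
  have hc : Continuous (mixedDeriv q d φ) := (contDiff_mixedDeriv q d φ.contDiff).continuous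
  have hK : IsCompact (Set.pi univ fun _ : Fin d => Icc (0 : ℝ) 1) :=
    isCompact_univ_pi fun _ => isCompact_Icc
  obtain ⟨C, hC⟩ := hK.exists_bound_of_continuousOn hc.continuousOn
  have hr : cubeMeasure d = volume.restrict (Set.pi univ fun _ : Fin d => Icc (0 : ℝ) 1) := by
    rw [volume_pi, Measure.restrict_pi_pi]
  have hf : Integrable (f : (Fin d → ℝ) → ℝ) (cubeMeasure d) :=
    (Lp.memLp f).integrable (by norm_num)
  refine hf.mul_bdd (c := C) hc.aestronglyMeasurable ?_
  rw [hr]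
  exact (ae_restrict_iff' (MeasurableSet.univ_pi fun _ => measurableSet_Icc)).2
    (Eventually.of_forall hC)

/-- The null space of `D` in `L²`: all `f` with `D f = 0` in the sense of distributions on the
open cube. -/
def nullSpace (q d : ℕ) : Submodule ℝ (L2Cube d) where
  carrier := {f | ∀ φ : 𝓓(openCube d, ℝ), ∫ u, f u * mixedDeriv q d φ u ∂(cubeMeasure d) = 0}
  zero_mem' := by
    intro φ
    rw [integral_congr_ae (g := fun _ => (0 : ℝ)), integral_zero]
    filter_upwards [Lp.coeFn_zero ℝ 2 (cubeMeasure d)] with u hu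
    exact mul_eq_zero_of_left hu _
  add_mem' := by
    intro f g hf hg φ
    have e : ∫ u, (f + g : L2Cube d) u * mixedDeriv q d φ u ∂(cubeMeasure d) =
        ∫ u, (f u * mixedDeriv q d φ u + g u * mixedDeriv q d φ u) ∂(cubeMeasure d) := by
      refine integral_congr_ae ?_
      filter_upwards [Lp.coeFn_add f g] with u hu
      rw [hu, Pi.add_apply, add_mul]
    rw [e, integral_add (integrable_mul_mixedDeriv q f φ) (integrable_mul_mixedDeriv q g φ),
      hf φ, hg φ, add_zero]
  smul_mem' := by
    intro c f hf φ
    have e : ∫ u, (c • f : L2Cube d) u * mixedDeriv q d φ u ∂(cubeMeasure d) =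
        ∫ u, c * (f u * mixedDeriv q d φ u) ∂(cubeMeasure d) := by
      refine integral_congr_ae ?_
      filter_upwards [Lp.coeFn_smul c f] with u hu
      rw [hu, Pi.smul_apply, smul_eq_mul, mul_assoc]
    rw [e, integral_const_mul, hf φ, mul_zero]

/-- The `q`-th order Vitali total variation `‖D f‖₁`: the total variation of the distribution
`D f` on the open cube, i.e. the supremum of `∫ f D φ` over the test functions `φ` with `|φ| ≤ 1`.
It is finite exactly if `D f` is a finite signed measure, and equals `∫ |D f|` for smooth `f`. -/
def vitaliVariation (q : ℕ) {d : ℕ} (f : L2Cube d) : ℝ≥0∞ :=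
  ⨆ (φ : 𝓓(openCube d, ℝ)) (_ : ∀ u, |φ u| ≤ 1),
    ENNReal.ofReal (∫ u, f u * mixedDeriv q d φ u ∂(cubeMeasure d))

/-- The functions orthogonal to the null space of `D` with `q`-th order Vitali total variation
at most `r`. -/
def vitaliBall (q d : ℕ) (r : ℝ≥0∞) : Set (L2Cube d) :=
  {f | f ∈ (nullSpace q d)ᗮ ∧ vitaliVariation q f ≤ r}

end MARS

end

/-!
On the dyadic shells around `v`, cut off at level `n + 1`, the truncated power `ψ_v` is a polynomial
on dyadic intervals, except on the last shell. Expanding every factor of `ψ_{v₁} ⊗ ⋯ ⊗ ψ_{v_d}` in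
this way and keeping the products of total level at most `n` places the tensor in a hyperbolic cross
space of dimension of order `2 ^ n * n ^ (d - 1)`, up to an orthogonal remainder whose norm is small
because the `j`-th layer has norm at most `2 ^ (-j (q - 1/2))`. A cover of the convex hull at one
dyadic level is refined to the next: inside the hyperbolic cross space by comparing volumes,
orthogonally to it by Maurey's lemma. The logarithms of the sizes of the covers grow geometrically,
so that the last refinement decides the entropy of `𝓕`.

Integrating by parts in each variable shows that the tensors are, up to sign, `((q - 1)!) ^ d` times
fundamental solutions of `D`. Hence a test function `φ` satisfies `⟪D φ, f⟫ ≤ ((q - 1)!) ^ d` on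
`𝓕` exactly if `|φ| ≤ 1`: among the functions orthogonal to the null space, those of variation
at most `((q - 1)!) ^ d` form the bipolar of `𝓕`. As `𝓕` is convex and compact, this is the
projection of `𝓕`. Projections are contractions, so the bound on the entropy of `𝓕` carries over.
-/

namespace MARS

section CoveringNumbers

variable {X Y : Type*} [PseudoMetricSpace X] [PseudoMetricSpace Y]

lemma externalCoveringNumber_le_natCast_iff {ε : ℝ≥0} {T : Set X} {N : ℕ} :
    Metric.externalCoveringNumber ε T ≤ N ↔
      ∃ S : Finset X, S.card ≤ N ∧ ∀ x ∈ T, ∃ s ∈ S, dist x s ≤ ε := by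
  constructor
  · intro h
    have hlt : Metric.externalCoveringNumber ε T < (N : ℕ∞) + 1 :=
      ENat.lt_natCast_add_one_iff.2 h
    obtain ⟨C, hC, hCN⟩ := by simpa only [Metric.externalCoveringNumber, iInf_lt_iff] using hlt
    have hCN : C.encard ≤ N := Order.le_of_lt_add_one hCN
    have hCf : C.Finite := finite_of_encard_le_coe hCN
    refine ⟨hCf.toFinset, ?_, fun x hx => ?_⟩
    · rwa [hCf.encard_eq_coe_toFinset_card, Nat.cast_le] at hCN
    · obtain ⟨s, hs, hxs⟩ := hC hx
      exact ⟨s, hCf.mem_toFinset.2 hs, by exact_mod_cast (edist_le_coe.1 hxs)⟩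
  · rintro ⟨S, hS, hT⟩
    have hcover : Metric.IsCover ε T (S : Set X) := fun x hx => by
      obtain ⟨s, hs, hxs⟩ := hT x hx
      exact ⟨s, hs, edist_le_coe.2 (by exact_mod_cast hxs)⟩
    calc Metric.externalCoveringNumber ε T ≤ (S : Set X).encard :=
          hcover.externalCoveringNumber_le_encard
      _ = S.card := encard_coe_eq_coe_finsetCard S
      _ ≤ N := by exact_mod_cast hS

lemma externalCoveringNumber_closure_le_natCast {ε : ℝ≥0} {T : Set X} {N : ℕ}
    (h : Metric.externalCoveringNumber ε T ≤ N) :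
    Metric.externalCoveringNumber ε (closure T) ≤ N := by
  obtain ⟨S, hS, hT⟩ := externalCoveringNumber_le_natCast_iff.1 h
  refine externalCoveringNumber_le_natCast_iff.2 ⟨S, hS, fun x hx => ?_⟩
  have hclosed : IsClosed (⋃ s ∈ S, Metric.closedBall s ε) :=
    isClosed_biUnion_finset fun s _ => Metric.isClosed_closedBall
  have hsub : T ⊆ ⋃ s ∈ S, Metric.closedBall s ε := fun y hy => by simpa using hT y hy
  simpa using hclosed.closure_subset_iff.2 hsub hx

lemma externalCoveringNumber_image_le {K ε : ℝ≥0} {f : X → Y} (hf : LipschitzWith K f)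
    (T : Set X) :
    Metric.externalCoveringNumber (K * ε) (f '' T) ≤ Metric.externalCoveringNumber ε T :=
  le_iInf₂ fun C hC =>
    (hC.image_lipschitz hf).externalCoveringNumber_le_encard.trans (encard_image_le f C)

lemma externalCoveringNumber_le_mul {r R : ℝ≥0} {T : Set X} {M N : ℕ}
    (hT : Metric.externalCoveringNumber R T ≤ M)
    (hball : ∀ x, Metric.externalCoveringNumber r (T ∩ Metric.closedBall x R) ≤ N) :
    Metric.externalCoveringNumber r T ≤ ((M * N : ℕ) : ℕ∞) := by
  classical
  obtain ⟨S, hS, hTS⟩ := externalCoveringNumber_le_natCast_iff.1 hT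
  choose C hC hCball using fun x => externalCoveringNumber_le_natCast_iff.1 (hball x)
  refine externalCoveringNumber_le_natCast_iff.2 ⟨S.biUnion C, ?_, fun x hx => ?_⟩
  · exact (Finset.card_biUnion_le_card_mul S C N fun s _ => hC s).trans
      (Nat.mul_le_mul_right N hS)
  · obtain ⟨s, hs, hxs⟩ := hTS x hx
    obtain ⟨c, hc, hxc⟩ := hCball s x ⟨hx, hxs⟩
    exact ⟨c, Finset.mem_biUnion.2 ⟨s, hs, hc⟩, hxc⟩

lemma externalCoveringNumber_union_neg_le {E : Type*} [SeminormedAddCommGroup E] {Z : Set E}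
    {ε : ℝ≥0} {N : ℕ} (h : Metric.externalCoveringNumber ε Z ≤ N) :
    Metric.externalCoveringNumber ε (Z ∪ -Z) ≤ ((2 * N : ℕ) : ℕ∞) := by
  classical
  obtain ⟨S, hSN, hS⟩ := externalCoveringNumber_le_natCast_iff.1 h
  refine externalCoveringNumber_le_natCast_iff.2 ⟨S ∪ S.image Neg.neg, ?_, ?_⟩
  · have := Finset.card_union_le S (S.image Neg.neg)
    have := Finset.card_image_le (s := S) (f := Neg.neg)
    omega
  · rintro z (hz | hz)
    · obtain ⟨s, hs, hzs⟩ := hS z hz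
      exact ⟨s, Finset.mem_union_left _ hs, hzs⟩
    · obtain ⟨s, hs, hzs⟩ := hS (-z) hz
      exact ⟨-s, Finset.mem_union_right _ (Finset.mem_image_of_mem _ hs), by
        rwa [← dist_neg_neg, neg_neg]⟩

lemma coveringNumber_le_of_externalCoveringNumber_half_le {ε : ℝ≥0} {T : Set X} {N : ℕ}
    (h : Metric.externalCoveringNumber (ε / 2) T ≤ N) : Metric.coveringNumber ε T ≤ N := by
  have h2 := Metric.coveringNumber_two_mul_le_externalCoveringNumber (ε / 2) T
  rw [mul_div_cancel₀ ε two_ne_zero] at h2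
  exact h2.trans h

lemma entropy_le_of_externalCoveringNumber_half_le {ε : ℝ≥0} {T : Set X} {M : ℕ}
    (h : Metric.externalCoveringNumber (ε / 2) T ≤ ((2 ^ M : ℕ) : ℕ∞)) :
    entropy ε T ≤ ((M : ℝ) : EReal) := by
  have hcard : (Metric.coveringNumber ε T : ℝ≥0∞) ≤ ENNReal.ofReal (2 ^ M) := by
    calc (Metric.coveringNumber ε T : ℝ≥0∞) ≤ (((2 ^ M : ℕ) : ℕ∞) : ℝ≥0∞) :=
          ENat.toENNReal_mono (coveringNumber_le_of_externalCoveringNumber_half_le h)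
      _ = ENNReal.ofReal (2 ^ M) := by
          rw [ENat.toENNReal_coe, ← ENNReal.ofReal_natCast, Nat.cast_pow, Nat.cast_ofNat]
  calc entropy ε T ≤ ENNReal.log (ENNReal.ofReal (2 ^ M)) := ENNReal.log_monotone hcard
    _ = ((M * Real.log 2 : ℝ) : EReal) := by
        rw [ENNReal.log_ofReal_of_pos (by positivity), Real.log_pow]
    _ ≤ ((M : ℝ) : EReal) := EReal.coe_le_coe_iff.2 <|
        mul_le_of_le_one_right M.cast_nonneg (by linarith [Real.log_two_lt_d9])

end CoveringNumbers

section FiniteDimensional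

variable {E : Type*} [NormedAddCommGroup E] [NormedSpace ℝ E] [FiniteDimensional ℝ E]

lemma packingNumber_one_closedBall_two_le :
    Metric.packingNumber 1 (Metric.closedBall (0 : E) 2) ≤
      ((5 ^ Module.finrank ℝ E : ℕ) : ℕ∞) := by
  refine iSup_le fun C => iSup_le fun hC => iSup_le fun hsep => ?_
  have hcard (s : Finset E) (hs : (s : Set E) ⊆ C) : s.card ≤ 5 ^ Module.finrank ℝ E := by
    refine Besicovitch.card_le_of_separated s (fun c hc => by simpa using hC (hs hc))
      fun c hc d hd hcd => ?_
    have hdist : ((1 : ℝ≥0) : ℝ≥0∞) < edist c d := hsep (hs hc) (hs hd) hcd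
    rw [edist_nndist, ENNReal.coe_lt_coe, ← NNReal.coe_lt_coe, coe_nndist, dist_eq_norm] at hdist
    exact hdist.le
  by_contra! hlt
  obtain ⟨t, htC, ht⟩ := exists_subset_encard_eq (Order.add_one_le_of_lt hlt)
  have htf : t.Finite := finite_of_encard_eq_coe (k := 5 ^ Module.finrank ℝ E + 1) (mod_cast ht)
  have h := hcard htf.toFinset (by simpa using htC)
  rw [htf.encard_eq_coe_toFinset_card] at ht
  have ht : htf.toFinset.card = 5 ^ Module.finrank ℝ E + 1 := by exact_mod_cast ht
  omega

lemma externalCoveringNumber_closedBall_two_mul_le (x : E) {r : ℝ≥0} (hr : 0 < r) :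
    Metric.externalCoveringNumber r (Metric.closedBall x (2 * r)) ≤
      ((5 ^ Module.finrank ℝ E : ℕ) : ℕ∞) := by
  have hunit : Metric.externalCoveringNumber 1 (Metric.closedBall (0 : E) 2) ≤
      ((5 ^ Module.finrank ℝ E : ℕ) : ℕ∞) :=
    (Metric.externalCoveringNumber_le_coveringNumber _ _).trans <|
      (Metric.coveringNumber_le_packingNumber _ _).trans packingNumber_one_closedBall_two_le
  have hlip : LipschitzWith r fun y : E => x + (r : ℝ) • y :=
    LipschitzWith.of_dist_le_mul fun y z => by
      rw [dist_add_left, dist_smul₀, NNReal.norm_eq]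
  have himage : Metric.closedBall x (2 * r) ⊆
      (fun y : E => x + (r : ℝ) • y) '' Metric.closedBall 0 2 := fun y hy => by
    have hr' : (0 : ℝ) < r := hr
    refine ⟨(r : ℝ)⁻¹ • (y - x), ?_, by simp [hr.ne']⟩
    rw [mem_closedBall_iff_norm] at hy
    rwa [mem_closedBall_zero_iff, norm_smul, norm_inv, NNReal.norm_eq, inv_mul_le_iff₀ hr',
      mul_comm]
  calc Metric.externalCoveringNumber r (Metric.closedBall x (2 * r))
      ≤ Metric.externalCoveringNumber (r * 1)
          ((fun y : E => x + (r : ℝ) • y) '' Metric.closedBall 0 2) := by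
        rw [mul_one]; exact Metric.externalCoveringNumber_mono_set himage
    _ ≤ Metric.externalCoveringNumber 1 (Metric.closedBall (0 : E) 2) :=
        externalCoveringNumber_image_le hlip _
    _ ≤ _ := hunit

lemma externalCoveringNumber_closedBall_two_pow_mul_le (x : E) {r : ℝ≥0} (hr : 0 < r) (a : ℕ) :
    Metric.externalCoveringNumber r (Metric.closedBall x (2 ^ a * r)) ≤
      ((5 ^ (a * Module.finrank ℝ E) : ℕ) : ℕ∞) := by
  induction a generalizing r with
  | zero =>
    exact externalCoveringNumber_le_natCast_iff.2 ⟨{x}, by simp, fun y hy => ⟨x, by simpa using hy⟩⟩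
  | succ a ih =>
    have hdouble : Metric.externalCoveringNumber (2 * r) (Metric.closedBall x (2 ^ (a + 1) * r)) ≤
        ((5 ^ (a * Module.finrank ℝ E) : ℕ) : ℕ∞) := by
      have h := ih (r := 2 * r) (by positivity)
      rwa [NNReal.coe_mul, NNReal.coe_ofNat, ← mul_assoc, ← pow_succ] at h
    have hstep (y : E) : Metric.externalCoveringNumber r
        (Metric.closedBall x (2 ^ (a + 1) * r) ∩ Metric.closedBall y (2 * r : ℝ≥0)) ≤
          ((5 ^ Module.finrank ℝ E : ℕ) : ℕ∞) :=
      (Metric.externalCoveringNumber_mono_set inter_subset_right).trans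
        (externalCoveringNumber_closedBall_two_mul_le y hr)
    rw [add_one_mul, pow_add 5]
    exact externalCoveringNumber_le_mul hdouble hstep

end FiniteDimensional

section ConvexHull

variable {H : Type*} [NormedAddCommGroup H] [InnerProductSpace ℝ H] {Z : Set H}

/- Maurey's lemma. The points are chosen greedily, each one in a half-space that contains `x`,
instead of at random. -/
lemma exists_norm_nsmul_sub_sum_sq_le {r : ℝ} (hZ : ∀ z ∈ Z, ‖z‖ ≤ r) {x : H}
    (hx : x ∈ convexHull ℝ Z) (k : ℕ) :
    ∃ z : Fin k → H, (∀ i, z i ∈ Z) ∧ ‖(k : ℝ) • x - ∑ i, z i‖ ^ 2 ≤ k * (2 * r) ^ 2 := by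
  induction k with
  | zero => exact ⟨Fin.elim0, fun i => i.elim0, by simp⟩
  | succ k ih =>
    obtain ⟨z, hz, hk⟩ := ih
    obtain ⟨w, hw, hxw⟩ :=
      (convexOn_norm convex_univ).exists_ge_of_mem_convexHull (subset_univ Z) hx
    set e := (k : ℝ) • x - ∑ i, z i with he
    obtain ⟨y, hy, hey⟩ : ∃ y ∈ Z, inner ℝ e x ≤ inner ℝ e y :=
      ((innerSL ℝ e).toLinearMap.convexOn convex_univ).exists_ge_of_mem_convexHull
        (subset_univ Z) hx
    refine ⟨Fin.snoc z y, fun i => ?_, ?_⟩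
    · refine Fin.lastCases ?_ (fun j => ?_) i
      · simpa only [Fin.snoc_last] using hy
      · simpa only [Fin.snoc_castSucc] using hz j
    · have hsplit : ((k + 1 : ℕ) : ℝ) • x - ∑ i, (Fin.snoc z y : Fin (k + 1) → H) i =
          e + (x - y) := by
        simp only [Fin.sum_univ_castSucc, Fin.snoc_castSucc, Fin.snoc_last, he, Nat.cast_add,
          Nat.cast_one, add_smul, one_smul]
        abel
      have hinner : inner ℝ e (x - y) ≤ 0 := by rw [inner_sub_right]; linarith
      have hnorm : ‖x - y‖ ^ 2 ≤ (2 * r) ^ 2 := by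
        gcongr
        linarith [norm_sub_le x y, hZ w hw, hZ y hy]
      calc ‖((k + 1 : ℕ) : ℝ) • x - ∑ i, (Fin.snoc z y : Fin (k + 1) → H) i‖ ^ 2
          = ‖e‖ ^ 2 + 2 * inner ℝ e (x - y) + ‖x - y‖ ^ 2 := by rw [hsplit, norm_add_sq_real]
        _ ≤ k * (2 * r) ^ 2 + (2 * r) ^ 2 := by linarith
        _ = ((k + 1 : ℕ) : ℝ) * (2 * r) ^ 2 := by push_cast; ring

lemma exists_norm_sub_average_le {r : ℝ≥0} (hZ : ∀ z ∈ Z, ‖z‖ ≤ r) {x : H}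
    (hx : x ∈ convexHull ℝ Z) {k : ℕ} (hk : 0 < k) :
    ∃ z : Fin k → H, (∀ i, z i ∈ Z) ∧ ‖x - (k : ℝ)⁻¹ • ∑ i, z i‖ ≤ 2 * r / √k := by
  obtain ⟨z, hz, hxz⟩ := exists_norm_nsmul_sub_sum_sq_le hZ hx k
  have hk0 : (0 : ℝ) < k := by exact_mod_cast hk
  refine ⟨z, hz, abs_le_of_sq_le_sq' ?_ (by positivity) |>.2⟩
  have hscale : x - (k : ℝ)⁻¹ • ∑ i, z i = (k : ℝ)⁻¹ • ((k : ℝ) • x - ∑ i, z i) := by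
    rw [smul_sub, inv_smul_smul₀ hk0.ne']
  calc ‖x - (k : ℝ)⁻¹ • ∑ i, z i‖ ^ 2 = ((k : ℝ)⁻¹ * ‖(k : ℝ) • x - ∑ i, z i‖) ^ 2 := by
        rw [hscale, norm_smul, norm_inv, Real.norm_natCast]
    _ = (k : ℝ)⁻¹ ^ 2 * ‖(k : ℝ) • x - ∑ i, z i‖ ^ 2 := mul_pow _ _ _
    _ ≤ (k : ℝ)⁻¹ ^ 2 * (k * (2 * r) ^ 2) := by gcongr
    _ = (2 * r / √k) ^ 2 := by rw [div_pow, Real.sq_sqrt hk0.le]; field_simp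

lemma externalCoveringNumber_convexHull_le_pow {r η : ℝ≥0} (hZ : ∀ z ∈ Z, ‖z‖ ≤ r) {N : ℕ}
    (hN : Metric.externalCoveringNumber η Z ≤ N) {k : ℕ} (hk : 0 < k) :
    Metric.externalCoveringNumber (2 * r / NNReal.sqrt k + η) (convexHull ℝ Z) ≤
      ((N ^ k : ℕ) : ℕ∞) := by
  classical
  obtain ⟨Y, hYN, hY⟩ := externalCoveringNumber_le_natCast_iff.1 hN
  refine externalCoveringNumber_le_natCast_iff.2
    ⟨(Fintype.piFinset fun _ : Fin k => Y).image fun y => (k : ℝ)⁻¹ • ∑ i, y i, ?_, fun x hx => ?_⟩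
  · refine Finset.card_image_le.trans ?_
    rw [Fintype.card_piFinset_const]
    exact Nat.pow_le_pow_left hYN k
  · obtain ⟨z, hz, hxz⟩ := exists_norm_sub_average_le hZ hx hk
    choose y hy hzy using fun i => hY (z i) (hz i)
    refine ⟨_, Finset.mem_image_of_mem _ (Fintype.mem_piFinset.2 hy), ?_⟩
    have hk0 : (0 : ℝ) < k := by exact_mod_cast hk
    have haverage : dist ((k : ℝ)⁻¹ • ∑ i, z i) ((k : ℝ)⁻¹ • ∑ i, y i) ≤ η := by
      rw [dist_smul₀, norm_inv, Real.norm_natCast, inv_mul_le_iff₀ hk0]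
      calc dist (∑ i, z i) (∑ i, y i) ≤ ∑ _i : Fin k, (η : ℝ) :=
            dist_sum_sum_le_of_le _ fun i _ => hzy i
        _ = k * η := by simp
    push_cast
    exact (dist_triangle _ _ _).trans (add_le_add (by rwa [dist_eq_norm]) haverage)

lemma externalCoveringNumber_add_le_mul_of_starProjection (L : Submodule ℝ H)
    [L.HasOrthogonalProjection] {ε δ : ℝ≥0} {T : Set H} {M N : ℕ}
    (hM : Metric.externalCoveringNumber ε (L.orthogonalProjectionOnto '' T) ≤ M)
    (hN : Metric.externalCoveringNumber δ (Lᗮ.starProjection '' T) ≤ N) :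
    Metric.externalCoveringNumber (ε + δ) T ≤ ((M * N : ℕ) : ℕ∞) := by
  classical
  obtain ⟨S, hSM, hS⟩ := externalCoveringNumber_le_natCast_iff.1 hM
  obtain ⟨R, hRN, hR⟩ := externalCoveringNumber_le_natCast_iff.1 hN
  refine externalCoveringNumber_le_natCast_iff.2
    ⟨Finset.image₂ (fun (s : L) r => (s : H) + r) S R,
      (Finset.card_image₂_le _ _ _).trans (Nat.mul_le_mul hSM hRN), fun x hx => ?_⟩
  obtain ⟨s, hs, hxs⟩ := hS _ (mem_image_of_mem _ hx)
  obtain ⟨r, hr, hxr⟩ := hR _ (mem_image_of_mem _ hx)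
  refine ⟨_, Finset.mem_image₂_of_mem hs hr, ?_⟩
  rw [← L.starProjection_add_starProjection_orthogonal x]
  exact (dist_add_add_le _ _ _ _).trans (add_le_add hxs hxr)

/- The component of a ball in `L` is covered by volume comparison, the component of the hull
orthogonal to `L` by Maurey's lemma. -/
lemma externalCoveringNumber_convexHull_le_mul (L : Submodule ℝ H) [FiniteDimensional ℝ L]
    {r η ρ : ℝ≥0} (hρ : 0 < ρ) (hZ : ∀ z ∈ Z, ‖Lᗮ.starProjection z‖ ≤ r) {N : ℕ}
    (hN : Metric.externalCoveringNumber η Z ≤ N) {k : ℕ} (hk : 0 < k)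
    (hrk : 2 * r / NNReal.sqrt k + η ≤ ρ) {a M : ℕ}
    (hM : Metric.externalCoveringNumber (2 ^ a * ρ) (convexHull ℝ Z) ≤ M) :
    Metric.externalCoveringNumber (2 * ρ) (convexHull ℝ Z) ≤
      ((M * (5 ^ (a * Module.finrank ℝ L) * N ^ k) : ℕ) : ℕ∞) := by
  have horth : Metric.externalCoveringNumber ρ (Lᗮ.starProjection '' convexHull ℝ Z) ≤
      ((N ^ k : ℕ) : ℕ∞) := by
    have hnet : Metric.externalCoveringNumber η (Lᗮ.starProjection '' Z) ≤ N := by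
      have h := externalCoveringNumber_image_le (ε := η) Lᗮ.lipschitzWith_starProjection Z
      rw [one_mul] at h
      exact h.trans hN
    have himage : Lᗮ.starProjection '' convexHull ℝ Z = convexHull ℝ (Lᗮ.starProjection '' Z) :=
      (Lᗮ.starProjection : H →ₗ[ℝ] H).image_convexHull Z
    rw [himage]
    exact (Metric.externalCoveringNumber_anti hrk).trans
      (externalCoveringNumber_convexHull_le_pow (forall_mem_image.2 hZ) hnet hk)
  refine externalCoveringNumber_le_mul hM fun x => ?_
  rw [two_mul]
  refine externalCoveringNumber_add_le_mul_of_starProjection L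
    (le_trans (Metric.externalCoveringNumber_mono_set ?_)
      (externalCoveringNumber_closedBall_two_pow_mul_le (L.orthogonalProjectionOnto x) hρ a))
    ((Metric.externalCoveringNumber_mono_set (image_mono inter_subset_left)).trans horth)
  rintro _ ⟨y, ⟨-, hy⟩, rfl⟩
  have hlip := L.lipschitzWith_orthogonalProjectionOnto.dist_le_mul y x
  rw [NNReal.coe_one, one_mul] at hlip
  exact hlip.trans (by simpa using hy)

end ConvexHull

/-- The radius of the dyadic covers at level `n`. The factor `√(n + 1)` over the approximation
error `2 ^ (-n q)` produces the factor `log (1 / ε) ^ (1 / (2 q))` of the entropy. -/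
noncomputable def dyadicRadius (q n : ℕ) : ℝ≥0 := NNReal.sqrt (n + 1) / 2 ^ (n * q)

/-- The order of the dimension of the hyperbolic cross of level `n` in `D + 1` variables, and of
the logarithm of the size of the dyadic covers at level `n`. -/
def dyadicCount (D n : ℕ) : ℕ := 2 ^ n * (n + 1) ^ D

/-- The set `T` has, at every dyadic level, a cover with the entropy of a class of functions of
`D + 1` variables with mixed smoothness `q`. -/
def HasDyadicCovers {X : Type*} [PseudoMetricSpace X] (q D : ℕ) (T : Set X) : Prop :=
  ∃ B C : ℕ, 0 < B ∧ ∀ n, Metric.externalCoveringNumber (B * dyadicRadius q n) T ≤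
    ((2 ^ (C * dyadicCount D n) : ℕ) : ℕ∞)

section DyadicScales

variable {q D n : ℕ}

lemma coe_dyadicRadius (q n : ℕ) :
    (dyadicRadius q n : ℝ) = √((n : ℝ) + 1) / 2 ^ (n * q) := by
  rw [dyadicRadius]
  push_cast
  rfl

lemma dyadicRadius_pos (q n : ℕ) : 0 < dyadicRadius q n :=
  div_pos (NNReal.sqrt_pos.2 (by positivity)) (by positivity)

lemma one_div_two_pow_le_dyadicRadius (q n : ℕ) : 1 / 2 ^ (n * q) ≤ dyadicRadius q n := by
  rw [dyadicRadius]
  gcongr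
  exact NNReal.one_le_sqrt.2 (by simp)

lemma dyadicRadius_le_two_pow_mul (q n : ℕ) :
    dyadicRadius q n ≤ 2 ^ q * dyadicRadius q (n + 1) := by
  have hscale : 2 ^ q * dyadicRadius q (n + 1) = NNReal.sqrt (n + 1 + 1) / 2 ^ (n * q) := by
    rw [dyadicRadius, add_one_mul, pow_add, Nat.cast_add_one]
    field_simp
  rw [hscale, dyadicRadius]
  gcongr
  exact le_self_add

lemma dyadicRadius_le_mul_one_half_pow (hq : 1 ≤ q) (n : ℕ) :
    (dyadicRadius q n : ℝ) ≤ (n + 1) * (1 / 2) ^ n := by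
  have hsqrt : √((n : ℝ) + 1) ≤ n + 1 :=
    Real.sqrt_le_iff.2 ⟨by positivity, le_self_pow₀ (by linarith [n.cast_nonneg (α := ℝ)])
      two_ne_zero⟩
  have hpow : (2 : ℝ) ^ n ≤ 2 ^ (n * q) :=
    pow_le_pow_right₀ one_le_two (Nat.le_mul_of_pos_right n hq)
  rw [coe_dyadicRadius, one_div, inv_pow, ← div_eq_mul_inv]
  gcongr

lemma tendsto_dyadicRadius (hq : 1 ≤ q) :
    Tendsto (fun n => (dyadicRadius q n : ℝ)) atTop (𝓝 0) := by
  have hlinear := tendsto_self_mul_const_pow_of_lt_one (r := (1 : ℝ) / 2) (by norm_num)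
    (by norm_num)
  have hgeom := tendsto_pow_atTop_nhds_zero_of_lt_one (r := (1 : ℝ) / 2) (by norm_num)
    (by norm_num)
  refine squeeze_zero (fun n => NNReal.coe_nonneg _) (dyadicRadius_le_mul_one_half_pow hq) ?_
  simpa [add_mul] using hlinear.add hgeom

lemma exists_mul_dyadicRadius_le (hq : 1 ≤ q) (B : ℝ) {ε : ℝ} (hε : 0 < ε) :
    ∃ n, B * dyadicRadius q n ≤ ε := by
  have hlim : Tendsto (fun n => B * (dyadicRadius q n : ℝ)) atTop (𝓝 0) := by
    simpa using (tendsto_dyadicRadius hq).const_mul B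
  exact (hlim.eventually_le_const hε).exists

lemma exists_mul_dyadicRadius_succ_le_lt (hq : 1 ≤ q) {B ε : ℝ} (hε : 0 < ε) (hεB : ε < B) :
    ∃ n, B * dyadicRadius q (n + 1) ≤ ε ∧ ε < B * dyadicRadius q n := by
  classical
  have hex := exists_mul_dyadicRadius_le hq B hε
  obtain ⟨n, hn⟩ : ∃ n, Nat.find hex = n + 1 := by
    refine Nat.exists_eq_succ_of_ne_zero fun h0 => hεB.not_ge ?_
    have hfind := Nat.find_spec hex
    rw [h0] at hfind
    simpa [coe_dyadicRadius] using hfind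
  exact ⟨n, hn ▸ Nat.find_spec hex, not_le.1 (Nat.find_min hex (by omega))⟩

lemma succ_le_dyadicCount (D n : ℕ) : n + 1 ≤ dyadicCount D n :=
  n.lt_two_pow_self.nat_succ_le.trans (Nat.le_mul_of_pos_right _ (by positivity))

lemma two_mul_dyadicCount_le (D n : ℕ) : 2 * dyadicCount D n ≤ dyadicCount D (n + 1) := by
  rw [dyadicCount, dyadicCount, pow_succ, mul_comm (2 ^ n) 2, mul_assoc]
  gcongr
  omega

lemma sqrt_div_sqrt_le_mul_dyadicRadius (hq : 1 ≤ q) (A : ℕ) {k : ℕ} (hk : 0 < k)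
    (hkn : dyadicCount D n ≤ k * (n + 1)) :
    NNReal.sqrt (A * (n + 1) ^ D / 2 ^ (n * (2 * q - 1))) / NNReal.sqrt k ≤
      A * dyadicRadius q n := by
  have hexp : n * q * 2 = n * (2 * q - 1) + n := by
    obtain ⟨q, rfl⟩ := Nat.exists_eq_add_of_le' hq
    rw [show 2 * (q + 1) - 1 = 2 * q + 1 by omega]
    ring
  have hA : (A : ℝ≥0) ≤ A ^ 2 := by exact_mod_cast Nat.le_self_pow two_ne_zero A
  have hkn' : (2 : ℝ≥0) ^ n * (n + 1) ^ D ≤ k * (n + 1) := by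
    exact_mod_cast hkn
  have : (0 : ℝ≥0) < k := by exact_mod_cast hk
  rw [← NNReal.sqrt_div, NNReal.sqrt_le_iff_le_sq, dyadicRadius, mul_pow, div_pow,
    NNReal.sq_sqrt, ← pow_mul, hexp, pow_add, div_div, ← mul_div_assoc,
    div_le_div_iff₀ (by positivity) (by positivity)]
  calc (A : ℝ≥0) * (n + 1) ^ D * (2 ^ (n * (2 * q - 1)) * 2 ^ n)
      = A * 2 ^ (n * (2 * q - 1)) * (2 ^ n * (n + 1) ^ D) := by ring
    _ ≤ A ^ 2 * 2 ^ (n * (2 * q - 1)) * (k * (n + 1)) := by gcongr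
    _ = _ := by ring

end DyadicScales

section DyadicCoversConvexHull

variable {H : Type*} [NormedAddCommGroup H] [InnerProductSpace ℝ H] {Z : Set H} {q D A : ℕ}

lemma externalCoveringNumber_convexHull_le_of_dyadic (hq : 1 ≤ q) {n : ℕ} (L : Submodule ℝ H)
    [FiniteDimensional ℝ L] (hL : Module.finrank ℝ L ≤ A * dyadicCount D n)
    (hZL : ∀ z ∈ Z, ‖Lᗮ.starProjection z‖ ≤
      NNReal.sqrt (A * (n + 1) ^ D / 2 ^ (n * (2 * q - 1))))
    (hZ : Metric.externalCoveringNumber (1 / 2 ^ (n * q)) Z ≤ ((2 ^ (A * (n + 1)) : ℕ) : ℕ∞))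
    {a M : ℕ} (hM : Metric.externalCoveringNumber (2 ^ a * ((2 * A + 1) * dyadicRadius q n))
      (convexHull ℝ Z) ≤ M) :
    Metric.externalCoveringNumber (2 * ((2 * A + 1) * dyadicRadius q n)) (convexHull ℝ Z) ≤
      ((M * 2 ^ ((3 * a + 2) * A * dyadicCount D n) : ℕ) : ℕ∞) := by
  set W := dyadicCount D n
  set k := W / (n + 1) + 1 with hk
  have hk0 : 0 < k := Nat.succ_pos _
  have hkW : W ≤ k * (n + 1) := (Nat.lt_div_mul_add (Nat.succ_pos n)).le.trans (by rw [hk]; lia)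
  have hWk : (n + 1) * k ≤ 2 * W := by
    have := Nat.mul_div_le W (n + 1)
    have : n + 1 ≤ W := succ_le_dyadicCount D n
    rw [hk, mul_add, mul_one]
    omega
  have hradius : 2 * NNReal.sqrt (A * (n + 1) ^ D / 2 ^ (n * (2 * q - 1))) / NNReal.sqrt k +
      1 / 2 ^ (n * q) ≤ (2 * A + 1) * dyadicRadius q n := by
    rw [mul_div_assoc, add_mul, one_mul, mul_assoc]
    gcongr
    · exact sqrt_div_sqrt_le_mul_dyadicRadius hq A hk0 hkW
    · exact one_div_two_pow_le_dyadicRadius q n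
  refine (externalCoveringNumber_convexHull_le_mul L
    (mul_pos (by positivity) (dyadicRadius_pos q n)) hZL hZ hk0 hradius hM).trans ?_
  have hball : 5 ^ (a * Module.finrank ℝ L) ≤ 2 ^ (3 * a * A * W) :=
    calc 5 ^ (a * Module.finrank ℝ L) ≤ (2 ^ 3) ^ (a * (A * W)) := by gcongr <;> norm_num
      _ = 2 ^ (3 * a * A * W) := by rw [← pow_mul]; ring_nf
  have hmaurey : (2 ^ (A * (n + 1))) ^ k ≤ 2 ^ (2 * A * W) :=
    calc (2 ^ (A * (n + 1))) ^ k = 2 ^ (A * ((n + 1) * k)) := by rw [← pow_mul, mul_assoc]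
      _ ≤ 2 ^ (A * (2 * W)) := by gcongr; norm_num
      _ = 2 ^ (2 * A * W) := by ring_nf
  rw [Nat.cast_le, show (3 * a + 2) * A * W = 3 * a * A * W + 2 * A * W by ring, pow_add 2]
  gcongr

theorem hasDyadicCovers_convexHull (hq : 1 ≤ q) (hZ : ∀ z ∈ Z, ‖z‖ ≤ 1)
    (hL : ∀ n : ℕ, ∃ (L : Submodule ℝ H) (_ : FiniteDimensional ℝ L),
      Module.finrank ℝ L ≤ A * dyadicCount D n ∧
      ∀ z ∈ Z, ‖Lᗮ.starProjection z‖ ≤ NNReal.sqrt (A * (n + 1) ^ D / 2 ^ (n * (2 * q - 1))))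
    (hnet : ∀ n : ℕ, Metric.externalCoveringNumber (1 / 2 ^ (n * q)) Z ≤
      ((2 ^ (A * (n + 1)) : ℕ) : ℕ∞)) :
    HasDyadicCovers q D (convexHull ℝ Z) := by
  set C := (3 * (q + 1) + 2) * A
  refine ⟨2 * (2 * A + 1), 2 * C, by omega, fun n => ?_⟩
  induction n with
  | zero =>
    have hball : convexHull ℝ Z ⊆ Metric.closedBall 0 1 :=
      convexHull_min (fun z hz => by simpa using hZ z hz) (convex_closedBall _ _)
    refine externalCoveringNumber_le_natCast_iff.2
      ⟨{0}, Nat.one_le_two_pow, fun x hx => ⟨0, Finset.mem_singleton_self 0, ?_⟩⟩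
    have hx : dist x 0 ≤ 1 := hball hx
    push_cast
    rw [coe_dyadicRadius]
    simpa using hx.trans (by linarith [A.cast_nonneg (α := ℝ)])
  | succ n ih =>
    obtain ⟨L, _, hLdim, hZL⟩ := hL (n + 1)
    have hprev : Metric.externalCoveringNumber
        (2 ^ (q + 1) * ((2 * A + 1) * dyadicRadius q (n + 1))) (convexHull ℝ Z) ≤
          ((2 ^ (2 * C * dyadicCount D n) : ℕ) : ℕ∞) := by
      refine (Metric.externalCoveringNumber_anti ?_).trans ih
      push_cast
      calc 2 * (2 * (A : ℝ≥0) + 1) * dyadicRadius q n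
          ≤ 2 * (2 * A + 1) * (2 ^ q * dyadicRadius q (n + 1)) := by
            gcongr; exact dyadicRadius_le_two_pow_mul q n
        _ = 2 ^ (q + 1) * ((2 * A + 1) * dyadicRadius q (n + 1)) := by ring
    have hnext := externalCoveringNumber_convexHull_le_of_dyadic hq L hLdim hZL (hnet (n + 1)) hprev
    rw [← mul_assoc] at hnext
    push_cast at hnext ⊢
    refine hnext.trans ?_
    rw [← pow_add]
    refine pow_le_pow_right₀ one_le_two ?_
    have := Nat.mul_le_mul_left C (two_mul_dyadicCount_le D n)
    lia

theorem hasDyadicCovers_absConvexHull (hq : 1 ≤ q) (hZ : ∀ z ∈ Z, ‖z‖ ≤ 1)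
    (hL : ∀ n : ℕ, ∃ (L : Submodule ℝ H) (_ : FiniteDimensional ℝ L),
      Module.finrank ℝ L ≤ A * dyadicCount D n ∧
      ∀ z ∈ Z, ‖Lᗮ.starProjection z‖ ≤ NNReal.sqrt (A * (n + 1) ^ D / 2 ^ (n * (2 * q - 1))))
    (hnet : ∀ n : ℕ, Metric.externalCoveringNumber (1 / 2 ^ (n * q)) Z ≤
      ((2 ^ (A * (n + 1)) : ℕ) : ℕ∞)) :
    HasDyadicCovers q D (absConvexHull ℝ Z) := by
  have hA : A ≤ A + 1 := A.le_succ
  rw [← convexHull_union_neg_eq_absConvexHull]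
  refine hasDyadicCovers_convexHull (A := A + 1) hq ?_ (fun n => ?_) fun n => ?_
  · rintro z (hz | hz)
    · exact hZ z hz
    · simpa using hZ (-z) hz
  · obtain ⟨L, _, hLdim, hZL⟩ := hL n
    have hmono : NNReal.sqrt (A * (n + 1) ^ D / 2 ^ (n * (2 * q - 1))) ≤
        NNReal.sqrt ((A + 1 : ℕ) * (n + 1) ^ D / 2 ^ (n * (2 * q - 1))) := by gcongr
    refine ⟨L, inferInstance, hLdim.trans (Nat.mul_le_mul_right _ hA), ?_⟩
    rintro z (hz | hz)
    · exact (hZL z hz).trans hmono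
    · have h := hZL (-z) hz
      rw [map_neg, norm_neg] at h
      exact h.trans hmono
  · refine (externalCoveringNumber_union_neg_le (hnet n)).trans (Nat.cast_le.2 ?_)
    rw [← pow_succ']
    exact Nat.pow_le_pow_right two_pos (by lia)

end DyadicCoversConvexHull

namespace HasDyadicCovers

variable {X Y : Type*} [PseudoMetricSpace X] [PseudoMetricSpace Y] {q D : ℕ} {T : Set X}

lemma closure (h : HasDyadicCovers q D T) : HasDyadicCovers q D (closure T) := by
  obtain ⟨B, C, hB, h⟩ := h
  exact ⟨B, C, hB, fun n => externalCoveringNumber_closure_le_natCast (h n)⟩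

lemma mono {T' : Set X} (h : HasDyadicCovers q D T) (hT : T' ⊆ T) : HasDyadicCovers q D T' := by
  obtain ⟨B, C, hB, h⟩ := h
  exact ⟨B, C, hB, fun n => (Metric.externalCoveringNumber_mono_set hT).trans (h n)⟩

lemma image (h : HasDyadicCovers q D T) {f : X → Y} (hf : LipschitzWith 1 f) :
    HasDyadicCovers q D (f '' T) := by
  obtain ⟨B, C, hB, h⟩ := h
  refine ⟨B, C, hB, fun n => ?_⟩
  have := externalCoveringNumber_image_le (ε := B * dyadicRadius q n) hf T
  rw [one_mul] at this
  exact this.trans (h n)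

end HasDyadicCovers

section EntropyRate

variable {q n : ℕ} {B ε : ℝ}

lemma two_pow_mul_lt_of_lt_mul_dyadicRadius (hε : 0 < ε) (h : ε / 2 < B * dyadicRadius q n) :
    (2 : ℝ) ^ (n * q) < 2 * B * √(n + 1) / ε := by
  rw [coe_dyadicRadius, ← mul_div_assoc, lt_div_iff₀ (by positivity)] at h
  rw [lt_div_iff₀ hε]
  linarith

lemma le_eight_mul_log_of_lt_mul_dyadicRadius (hq : 1 ≤ q) (hB : 0 < B) (hε : 0 < ε)
    (hεB : ε ≤ 1 / (2 * B)) (h : ε / 2 < B * dyadicRadius q n) :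
    (n : ℝ) ≤ 8 * Real.log (1 / ε) := by
  have hupper : ((2 : ℝ) ^ (n * q)) ^ 2 ≤ (2 * B / ε) ^ 2 * 2 ^ n := by
    calc ((2 : ℝ) ^ (n * q)) ^ 2 ≤ (2 * B * √(n + 1) / ε) ^ 2 := by
          gcongr; exact (two_pow_mul_lt_of_lt_mul_dyadicRadius hε h).le
      _ = (2 * B / ε) ^ 2 * (n + 1) := by
          rw [mul_div_right_comm, mul_pow, Real.sq_sqrt (by positivity)]
      _ ≤ (2 * B / ε) ^ 2 * 2 ^ n := by
          gcongr; exact_mod_cast n.lt_two_pow_self.nat_succ_le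
  have hlower : (2 : ℝ) ^ n * 2 ^ n ≤ ((2 : ℝ) ^ (n * q)) ^ 2 := by
    rw [← pow_mul, ← pow_add]
    exact pow_le_pow_right₀ one_le_two (by nlinarith [Nat.le_mul_of_pos_right n hq])
  have hpow : (2 : ℝ) ^ n ≤ (2 * B / ε) ^ 2 :=
    le_of_mul_le_mul_right (hlower.trans hupper) (by positivity)
  have hlogB : Real.log (2 * B) ≤ Real.log (1 / ε) :=
    Real.log_le_log (by positivity) ((le_one_div (by positivity) hε).2 hεB)
  have hlog := Real.log_le_log (by positivity) hpow
  rw [Real.log_pow, Real.log_pow, div_eq_mul_one_div,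
    Real.log_mul (by positivity) (by positivity)] at hlog
  push_cast at hlog
  nlinarith [Real.log_two_gt_d9, n.cast_nonneg (α := ℝ)]

lemma two_pow_le_of_lt_mul_dyadicRadius (hq : 1 ≤ q) (hB : 0 ≤ B) (hε : 0 < ε)
    (h : ε / 2 < B * dyadicRadius q n) {L : ℝ} (hL : 0 ≤ L) (hn : (n : ℝ) + 1 ≤ 10 * L) :
    (2 : ℝ) ^ n ≤
      (2 * B * √10) ^ (1 / (q : ℝ)) * (L ^ (1 / (2 * (q : ℝ))) * ε ^ (-(1 / (q : ℝ)))) := by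
  have hsqrt : √((n : ℝ) + 1) ≤ √10 * √L := by
    rw [← Real.sqrt_mul (by norm_num)]
    exact Real.sqrt_le_sqrt hn
  have hpow : (2 : ℝ) ^ (n * q) ≤ 2 * B * √10 * (√L * ε⁻¹) := by
    calc (2 : ℝ) ^ (n * q) ≤ 2 * B * √((n : ℝ) + 1) / ε :=
          (two_pow_mul_lt_of_lt_mul_dyadicRadius hε h).le
      _ ≤ 2 * B * (√10 * √L) / ε := by gcongr
      _ = 2 * B * √10 * (√L * ε⁻¹) := by ring
  calc (2 : ℝ) ^ n = ((2 : ℝ) ^ (n * q)) ^ (1 / (q : ℝ)) := by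
        rw [pow_mul, one_div, Real.pow_rpow_inv_natCast (by positivity) (by omega)]
    _ ≤ (2 * B * √10 * (√L * ε⁻¹)) ^ (1 / (q : ℝ)) :=
        Real.rpow_le_rpow (by positivity) hpow (by positivity)
    _ = _ := by
        have hq' : (q : ℝ) ≠ 0 := by positivity
        rw [Real.mul_rpow (x := 2 * B * √10) (by positivity) (by positivity),
          Real.mul_rpow (x := √L) (by positivity) (by positivity), Real.sqrt_eq_rpow L,
          ← Real.rpow_mul hL, Real.inv_rpow hε.le, ← Real.rpow_neg hε.le]
        congr 3
        field_simp

theorem HasDyadicCovers.entropy_le {X : Type*} [PseudoMetricSpace X] {q D : ℕ} (hq : 1 ≤ q)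
    {T : Set X} (h : HasDyadicCovers q D T) :
    ∃ C : ℝ, ∀ᶠ ε : ℝ in 𝓝[>] 0, entropy ε.toNNReal T ≤
      ((C * (ε ^ (-(1 / (q : ℝ))) * Real.log (1 / ε) ^ D *
        Real.log (1 / ε) ^ (1 / (2 * (q : ℝ)))) : ℝ) : EReal) := by
  obtain ⟨B, C, hB, h⟩ := h
  have hB1 : (1 : ℝ) ≤ B := by exact_mod_cast hB
  refine ⟨2 * C * 10 ^ D * (2 * B * √10) ^ (1 / (q : ℝ)), ?_⟩
  filter_upwards [self_mem_nhdsWithin,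
    Ioo_mem_nhdsGT (show (0 : ℝ) < 1 / (2 * B) by positivity),
    Ioo_mem_nhdsGT (Real.exp_pos (-1))] with ε (hε : 0 < ε) ⟨_, hεB⟩ ⟨_, hεe⟩
  set L := Real.log (1 / ε) with hL
  have hL1 : 1 ≤ L := by
    rw [hL, Real.le_log_iff_exp_le (by positivity), le_one_div (by positivity) hε, one_div,
      ← Real.exp_neg]
    exact hεe.le
  have hεB' : ε / 2 < B := by
    rw [lt_div_iff₀ (by positivity)] at hεB
    nlinarith
  obtain ⟨n, hn, hn'⟩ := exists_mul_dyadicRadius_succ_le_lt hq (half_pos hε) hεB'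
  have hnL : (n : ℝ) ≤ 8 * L :=
    le_eight_mul_log_of_lt_mul_dyadicRadius hq (by positivity) hε hεB.le hn'
  have hradius : B * dyadicRadius q (n + 1) ≤ ε.toNNReal / 2 := by
    rw [← NNReal.coe_le_coe]
    push_cast
    rwa [Real.coe_toNNReal _ hε.le]
  refine (entropy_le_of_externalCoveringNumber_half_le
    ((Metric.externalCoveringNumber_anti hradius).trans (h (n + 1)))).trans
      (EReal.coe_le_coe_iff.2 ?_)
  rw [dyadicCount]
  push_cast
  calc (C : ℝ) * (2 ^ (n + 1) * ((n : ℝ) + 1 + 1) ^ D)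
      ≤ C * (2 * ((2 * B * √10) ^ (1 / (q : ℝ)) *
          (L ^ (1 / (2 * (q : ℝ))) * ε ^ (-(1 / (q : ℝ))))) * (10 * L) ^ D) := by
        rw [pow_succ']
        gcongr
        · exact two_pow_le_of_lt_mul_dyadicRadius hq (by positivity) hε hn' (by linarith)
            (by linarith)
        · linarith
    _ = _ := by rw [mul_pow]; ring

end EntropyRate

section Tensor

variable {ι : Type*} [Fintype ι] {α : ι → Type*} [∀ i, MeasurableSpace (α i)]
  {μ : ∀ i, Measure (α i)}

lemma prod_update_apply [DecidableEq ι] (f : ∀ i, Lp ℝ 2 (μ i)) (i : ι) (g : Lp ℝ 2 (μ i))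
    (u : ∀ i, α i) :
    ∏ k, (Function.update f i g k : α k → ℝ) (u k) =
      g (u i) * ∏ k ∈ Finset.univ.erase i, f k (u k) := by
  rw [← Finset.mul_prod_erase _ _ (Finset.mem_univ i), Function.update_self]
  congr 1
  refine Finset.prod_congr rfl fun k hk => ?_
  rw [Function.update_of_ne (Finset.ne_of_mem_erase hk)]

variable [∀ i, SigmaFinite (μ i)]

lemma memLp_two_prod {f : ∀ i, α i → ℝ} (hf : ∀ i, MemLp (f i) 2 (μ i)) :
    MemLp (fun u : ∀ i, α i => ∏ i, f i (u i)) 2 (Measure.pi μ) := by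
  have hmeas : AEStronglyMeasurable (fun u : ∀ i, α i => ∏ i, f i (u i)) (Measure.pi μ) :=
    Finset.aestronglyMeasurable_fun_prod _ fun i _ =>
      (hf i).1.comp_quasiMeasurePreserving (Measure.quasiMeasurePreserving_eval _ i)
  rw [memLp_two_iff_integrable_sq hmeas]
  simp only [← Finset.prod_pow]
  exact Integrable.fintype_prod_dep fun i => (hf i).integrable_sq

variable (μ) in
/-- The tensor product `u ↦ ∏ i, f i (u i)` of square integrable functions `f i` of one variable,
as a multilinear map into the `L²` space of the product measure. -/
noncomputable def tensorL2 :
    MultilinearMap ℝ (fun i => Lp ℝ 2 (μ i)) (Lp ℝ 2 (Measure.pi μ)) where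
  toFun f := (memLp_two_prod fun i => Lp.memLp (f i)).toLp _
  map_update_add' f i g h := by
    rw [← MemLp.toLp_add, MemLp.toLp_eq_toLp_iff]
    filter_upwards [Measure.tendsto_eval_ae_ae.eventually (Lp.coeFn_add g h)] with u hu
    simp only [Pi.add_apply, prod_update_apply, Function.eval] at hu ⊢
    rw [hu, add_mul]
  map_update_smul' f i c g := by
    rw [← MemLp.toLp_const_smul, MemLp.toLp_eq_toLp_iff]
    filter_upwards [Measure.tendsto_eval_ae_ae.eventually (Lp.coeFn_smul c g)] with u hu
    simp only [Pi.smul_apply, prod_update_apply, Function.eval] at hu ⊢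
    rw [hu, smul_mul_assoc]

lemma coeFn_tensorL2 {f : ∀ i, Lp ℝ 2 (μ i)} {g : ∀ i, α i → ℝ} (h : ∀ i, f i =ᵐ[μ i] g i) :
    tensorL2 μ f =ᵐ[Measure.pi μ] fun u => ∏ i, g i (u i) := by
  filter_upwards [(memLp_two_prod fun i => Lp.memLp (f i)).coeFn_toLp, Measure.ae_eq_pi h]
    with u hu hfg
  exact hu.trans (Finset.prod_congr rfl fun i _ => congrFun hfg i)

lemma inner_tensorL2 (f g : ∀ i, Lp ℝ 2 (μ i)) :
    inner ℝ (tensorL2 μ f) (tensorL2 μ g) = ∏ i, inner ℝ (f i) (g i) := by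
  simp only [L2.inner_def]
  rw [← integral_fintype_prod_eq_prod]
  refine integral_congr_ae ?_
  filter_upwards [coeFn_tensorL2 fun i => ae_eq_refl (f i),
    coeFn_tensorL2 fun i => ae_eq_refl (g i)] with u hf hg
  rw [hf, hg]
  simp [Finset.prod_mul_distrib]

lemma norm_tensorL2 (f : ∀ i, Lp ℝ 2 (μ i)) : ‖tensorL2 μ f‖ = ∏ i, ‖f i‖ := by
  rw [← sq_eq_sq₀ (norm_nonneg _) (by positivity), ← Finset.prod_pow]
  simp only [← real_inner_self_eq_norm_sq, inner_tensorL2]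

end Tensor

lemma coeFn_sum_smul {ι α : Type*} [MeasurableSpace α] {μ : Measure α} {s : Finset ι}
    {f : ι → Lp ℝ 2 μ} {g : ι → α → ℝ} (h : ∀ i ∈ s, f i =ᵐ[μ] g i) (β : ι → ℝ) :
    (∑ i ∈ s, β i • f i : Lp ℝ 2 μ) =ᵐ[μ] fun u => ∑ i ∈ s, β i * g i u := by
  have h_smul : ∀ᵐ u ∂μ, ∀ i ∈ s, (β i • f i : Lp ℝ 2 μ) u = β i * g i u := by
    refine (ae_ball_iff s.countable_toSet).2 fun i hi => ?_
    filter_upwards [Lp.coeFn_smul (β i) (f i), h i hi] with u h_smul_apply h_apply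
    rw [h_smul_apply, Pi.smul_apply, h_apply, smul_eq_mul]
  filter_upwards [Lp.coeFn_finsetSum s fun i => β i • f i, h_smul] with u h_sum h_smul
  rw [h_sum, Finset.sum_apply]
  exact Finset.sum_congr rfl h_smul

section AbsConvexHull

variable {ι E : Type*} [AddCommGroup E] [Module ℝ E]

lemma sum_smul_mem_absConvexHull {Z : Set E} (hZ : Z.Nonempty) {t : Finset ι} {β : ι → ℝ}
    {e : ι → E} (he : ∀ i ∈ t, e i ∈ Z) (hβ : ∑ i ∈ t, |β i| ≤ 1) :
    ∑ i ∈ t, β i • e i ∈ absConvexHull ℝ Z := by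
  have h_zero : (0 : E) ∈ absConvexHull ℝ Z :=
    balanced_absConvexHull.zero_mem (absConvexHull_nonempty.2 hZ)
  have h_sign : ∀ i ∈ t, (SignType.sign (β i) : ℝ) • e i ∈ absConvexHull ℝ Z := fun i hi =>
    balanced_absConvexHull.smul_mem (by rcases SignType.sign (β i) <;> simp)
      (subset_absConvexHull (he i hi))
  have h_sum : ∑ i ∈ t, β i • e i = ∑ i ∈ t, |β i| • (SignType.sign (β i) : ℝ) • e i :=
    Finset.sum_congr rfl fun i _ => by rw [smul_smul, abs_mul_sign]
  have := convex_absConvexHull.sum_mem (s := absConvexHull ℝ Z) (t := t.insertNone)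
    (w := fun o => o.elim (1 - ∑ i ∈ t, |β i|) fun i => |β i|)
    (z := fun o => o.elim 0 fun i => (SignType.sign (β i) : ℝ) • e i)
    (by rintro (_ | i) _; exacts [sub_nonneg.2 hβ, abs_nonneg _]) (by simp)
    (by rintro (_ | i) hi; exacts [h_zero, h_sign i (by simpa using hi)])
  simpa [h_sum] using this

lemma exists_sum_smul_of_mem_absConvexHull_image {s : Set ι} {e : ι → E} {x : E}
    (hx : x ∈ absConvexHull ℝ (e '' s)) :
    ∃ (t : Finset ι) (β : ι → ℝ), ↑t ⊆ s ∧ ∑ i ∈ t, |β i| ≤ 1 ∧ x = ∑ i ∈ t, β i • e i := by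
  classical
  refine absConvexHull_min (t := {x | ∃ (t : Finset ι) (β : ι → ℝ),
    ↑t ⊆ s ∧ ∑ i ∈ t, |β i| ≤ 1 ∧ x = ∑ i ∈ t, β i • e i}) ?_ ⟨?_, ?_⟩ hx
  · rintro _ ⟨i, hi, rfl⟩
    exact ⟨{i}, 1, by simpa using hi, by simp, by simp⟩
  · rw [balanced_iff_smul_mem]
    rintro a ha _ ⟨t, β, ht, hβ, rfl⟩
    refine ⟨t, a • β, ht, ?_, by simp [Finset.smul_sum, smul_smul]⟩
    simp only [Pi.smul_apply, smul_eq_mul, abs_mul, ← Finset.mul_sum]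
    exact mul_le_one₀ ha (Finset.sum_nonneg fun i _ => abs_nonneg _) hβ
  · rintro _ ⟨t, β, ht, hβ, rfl⟩ _ ⟨t', β', ht', hβ', rfl⟩ a b ha hb hab
    refine ⟨t ∪ t', a • (t : Set ι).indicator β + b • (t' : Set ι).indicator β',
      by simp [ht, ht'], ?_, ?_⟩
    · calc
        _ ≤ ∑ i ∈ t ∪ t', (a * |(t : Set ι).indicator β i| + b * |(t' : Set ι).indicator β' i|) :=
          Finset.sum_le_sum fun i _ => (abs_add_le _ _).trans_eq <| by
            simp [abs_mul, abs_of_nonneg ha, abs_of_nonneg hb]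
        _ = a * ∑ i ∈ t, |β i| + b * ∑ i ∈ t', |β' i| := by
          rw [Finset.sum_add_distrib, ← Finset.mul_sum, ← Finset.mul_sum,
            Finset.sum_indicator_subset_of_eq_zero β (fun _ x => |x|)
              Finset.subset_union_left fun _ => abs_zero,
            Finset.sum_indicator_subset_of_eq_zero β' (fun _ x => |x|)
              Finset.subset_union_right fun _ => abs_zero]
        _ ≤ a * 1 + b * 1 := by gcongr
        _ = 1 := by linarith
    · simp only [Pi.add_apply, Pi.smul_apply, add_smul, Finset.sum_add_distrib, smul_eq_mul,
        mul_smul, ← Finset.smul_sum]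
      rw [Finset.sum_indicator_subset_of_eq_zero β (fun i x => x • e i)
          Finset.subset_union_left fun _ => zero_smul _ _,
        Finset.sum_indicator_subset_of_eq_zero β' (fun i x => x • e i)
          Finset.subset_union_right fun _ => zero_smul _ _]

end AbsConvexHull

section TruncPow

lemma measurable_truncPow (q : ℕ) (v : ℝ) : Measurable (truncPow q v) := by
  unfold truncPow
  exact Measurable.ite measurableSet_Ici (by fun_prop) measurable_const

lemma truncPow_nonneg (q : ℕ) (v u : ℝ) : 0 ≤ truncPow q v u := by
  unfold truncPow
  split_ifs with h
  · exact pow_nonneg (sub_nonneg.2 h) _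
  · exact le_rfl

lemma abs_truncPow_le (q : ℕ) (v : ℝ) {u : ℝ} (hu : u ≤ 1) :
    |truncPow q v u| ≤ |1 - v| ^ (q - 1) := by
  rw [abs_of_nonneg (truncPow_nonneg q v u)]
  unfold truncPow
  split_ifs with h
  · exact pow_le_pow_left₀ (sub_nonneg.2 h) (by linarith [le_abs_self (1 - v)]) _
  · positivity

lemma abs_truncPow_le_one (q : ℕ) {v u : ℝ} (hv : v ∈ Icc (0 : ℝ) 1) (hu : u ≤ 1) :
    |truncPow q v u| ≤ 1 :=
  (abs_truncPow_le q v hu).trans <| pow_le_one₀ (abs_nonneg _) <|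
    abs_le.2 ⟨by linarith [hv.2], by linarith [hv.1]⟩

lemma ae_unitMeasure_mem_Ico : ∀ᵐ u ∂unitMeasure, u ∈ Ico (0 : ℝ) 1 := by
  rw [unitMeasure, ← restrict_Ico_eq_restrict_Icc]
  exact ae_restrict_mem measurableSet_Ico

instance isProbabilityMeasure_unitMeasure : IsProbabilityMeasure unitMeasure :=
  ⟨by simp [unitMeasure]⟩

lemma norm_le_of_forall_mem_Ico {f : Lp ℝ 2 unitMeasure} {g : ℝ → ℝ} (hf : f =ᵐ[unitMeasure] g)
    {C : ℝ} (hC : 0 ≤ C) (hg : ∀ u ∈ Ico (0 : ℝ) 1, |g u| ≤ C) : ‖f‖ ≤ C := by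
  refine (Lp.norm_le_of_ae_bound hC ?_).trans_eq (by simp [measureUnivNNReal])
  filter_upwards [hf, ae_unitMeasure_mem_Ico] with u hfu hu
  exact hfu ▸ hg u hu

lemma norm_sq_le_of_abs_le_indicator_Icc {f : Lp ℝ 2 unitMeasure} {g : ℝ → ℝ}
    (hf : f =ᵐ[unitMeasure] g) {a b c : ℝ} (hab : a ≤ b)
    (hg : ∀ u ∈ Ico (0 : ℝ) 1, |g u| ≤ (Icc a b).indicator (fun _ => c) u) :
    ‖f‖ ^ 2 ≤ c ^ 2 * (b - a) := by
  have h_ne_top := measure_ne_top unitMeasure (Icc a b)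
  have h_norm : ‖f‖ ≤ ‖indicatorConstLp 2 measurableSet_Icc h_ne_top c‖ := by
    refine Lp.norm_le_norm_of_ae_le ?_
    filter_upwards [hf, ae_unitMeasure_mem_Ico, indicatorConstLp_coeFn (p := 2)
      (hs := measurableSet_Icc) (hμs := h_ne_top) (c := c)] with u hfu hu h_ind
    rw [hfu, h_ind, Real.norm_eq_abs, Real.norm_eq_abs]
    exact (hg u hu).trans (le_abs_self _)
  calc ‖f‖ ^ 2 ≤ (|c| * unitMeasure.real (Icc a b) ^ (1 / (2 : ℝ))) ^ 2 := by
        gcongr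
        simpa [norm_indicatorConstLp] using h_norm
    _ = c ^ 2 * unitMeasure.real (Icc a b) := by
        rw [← Real.sqrt_eq_rpow, mul_pow, sq_abs, Real.sq_sqrt measureReal_nonneg]
    _ ≤ c ^ 2 * volume.real (Icc a b) := by
        gcongr
        exact ENNReal.toReal_mono (by simp) (Measure.restrict_le_self _)
    _ = c ^ 2 * (b - a) := by rw [Real.volume_real_Icc_of_le hab]

lemma memLp_truncPow (q : ℕ) (v : ℝ) : MemLp (truncPow q v) 2 unitMeasure := by
  refine .of_bound (measurable_truncPow q v).aestronglyMeasurable (|1 - v| ^ (q - 1)) ?_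
  filter_upwards [ae_unitMeasure_mem_Ico] with u hu using abs_truncPow_le q v hu.2.le

/-- The truncated power `ψ_v` as an element of `L²[0, 1]`. -/
noncomputable def truncPowL2 (q : ℕ) (v : ℝ) : Lp ℝ 2 unitMeasure := (memLp_truncPow q v).toLp _

lemma coeFn_truncPowL2 (q : ℕ) (v : ℝ) : truncPowL2 q v =ᵐ[unitMeasure] truncPow q v :=
  MemLp.coeFn_toLp _

lemma truncPowClass_eq_image (q : ℕ) : truncPowClass q = truncPowL2 q '' Icc 0 1 := by
  ext f
  refine exists_congr fun v => and_congr_right fun _ => ⟨fun h => ?_, ?_⟩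
  · exact Lp.ext ((coeFn_truncPowL2 q v).trans h.symm)
  · rintro rfl
    exact coeFn_truncPowL2 q v

lemma norm_truncPowL2_le_one (q : ℕ) {v : ℝ} (hv : v ∈ Icc (0 : ℝ) 1) : ‖truncPowL2 q v‖ ≤ 1 :=
  norm_le_of_forall_mem_Ico (coeFn_truncPowL2 q v) zero_le_one
    fun _ hu => abs_truncPow_le_one q hv hu.2.le

/-- The tensor `ψ_{v₁} ⊗ ⋯ ⊗ ψ_{v_d}` as an element of `L²`. -/
noncomputable def tensorPowL2 (q : ℕ) {d : ℕ} (v : Fin d → ℝ) : L2Cube d :=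
  tensorL2 (fun _ => unitMeasure) fun k => truncPowL2 q (v k)

variable {d : ℕ} {v w : Fin d → ℝ}

lemma coeFn_tensorPowL2 (q : ℕ) (v : Fin d → ℝ) :
    tensorPowL2 q v =ᵐ[cubeMeasure d] tensorPow q v :=
  coeFn_tensorL2 fun k => coeFn_truncPowL2 q (v k)

lemma norm_tensorPowL2_le_one (q : ℕ) (hv : v ∈ Icc (0 : Fin d → ℝ) 1) :
    ‖tensorPowL2 q v‖ ≤ 1 := by
  rw [tensorPowL2, norm_tensorL2]
  exact Finset.prod_le_one (fun _ _ => norm_nonneg _)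
    fun k _ => norm_truncPowL2_le_one q ⟨hv.1 k, hv.2 k⟩

lemma absconvTensor_eq (q d : ℕ) :
    absconvTensor q d = closure (absConvexHull ℝ (tensorPowL2 q '' Icc (0 : Fin d → ℝ) 1)) := by
  classical
  unfold absconvTensor
  congr 1
  refine Subset.antisymm ?_ fun f hf => ?_
  · rintro f ⟨V, β, hV, hβ, hf⟩
    rw [Lp.ext (hf.trans (coeFn_sum_smul (fun v _ => coeFn_tensorPowL2 q v) β).symm)]
    refine sum_smul_mem_absConvexHull ((nonempty_Icc.2 zero_le_one).image _) (fun v hv => ?_) hβ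
    have hvV := fun k => hV k _ (Fintype.mem_piFinset.1 hv k)
    exact mem_image_of_mem _ ⟨fun k => (hvV k).1, fun k => (hvV k).2⟩
  · obtain ⟨t, β, ht, hβ, rfl⟩ := exists_sum_smul_of_mem_absConvexHull_image hf
    have h_sub : t ⊆ Fintype.piFinset fun k => t.image fun v => v k := fun v hv =>
      Fintype.mem_piFinset.2 fun k => Finset.mem_image_of_mem _ hv
    refine ⟨fun k => t.image fun v => v k, (t : Set _).indicator β, fun k x hx => ?_, ?_, ?_⟩
    · obtain ⟨v, hv, rfl⟩ := Finset.mem_image.1 hx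
      exact ⟨(ht hv).1 k, (ht hv).2 k⟩
    · rwa [Finset.sum_indicator_subset_of_eq_zero β (fun _ x => |x|) h_sub fun _ => abs_zero]
    · refine (coeFn_sum_smul (fun v _ => coeFn_tensorPowL2 q v) β).trans
        (Eventually.of_forall fun u => ?_)
      exact (Finset.sum_indicator_subset_of_eq_zero β (fun v x => x * tensorPow q v u) h_sub
        fun _ => zero_mul _).symm

end TruncPow

section TruncPowModulus

variable {q : ℕ} {v w : ℝ}

lemma truncPow_eq_max_pow (hq : 2 ≤ q) (v u : ℝ) : truncPow q v u = max (u - v) 0 ^ (q - 1) := by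
  unfold truncPow
  split_ifs with h
  · rw [max_eq_left (sub_nonneg.2 h)]
  · rw [max_eq_right (by linarith), zero_pow (by omega)]

lemma abs_truncPow_sub_le (hq : 2 ≤ q) (hv : v ∈ Icc (0 : ℝ) 1) (hw : w ∈ Icc (0 : ℝ) 1) {u : ℝ}
    (hu : u ≤ 1) : |truncPow q v u - truncPow q w u| ≤ q * |v - w| := by
  have h_le_one : ∀ x ∈ Icc (0 : ℝ) 1, |max (u - x) 0| ≤ 1 := fun x hx => by
    rw [abs_of_nonneg (le_max_right _ _)]
    exact max_le (by linarith [hx.1]) zero_le_one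
  have h_max : |max (u - v) 0 - max (u - w) 0| ≤ |v - w| := by
    refine (abs_max_sub_max_le_abs _ _ _).trans_eq ?_
    rw [sub_sub_sub_cancel_left, abs_sub_comm]
  rw [truncPow_eq_max_pow hq, truncPow_eq_max_pow hq]
  calc |max (u - v) 0 ^ (q - 1) - max (u - w) 0 ^ (q - 1)|
      ≤ |max (u - v) 0 - max (u - w) 0| * (q - 1 : ℕ) *
          max |max (u - v) 0| |max (u - w) 0| ^ (q - 1 - 1) := abs_pow_sub_pow_le _ _ _
    _ ≤ |v - w| * q * 1 := by
        gcongr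
        · exact Nat.sub_le q 1
        · exact pow_le_one₀ (le_max_of_le_left (abs_nonneg _))
            (max_le (h_le_one v hv) (h_le_one w hw))
    _ = q * |v - w| := by ring

lemma coeFn_truncPowL2_sub (q : ℕ) (v w : ℝ) :
    (truncPowL2 q v - truncPowL2 q w : Lp ℝ 2 unitMeasure) =ᵐ[unitMeasure]
      truncPow q v - truncPow q w :=
  (Lp.coeFn_sub _ _).trans ((coeFn_truncPowL2 q v).sub (coeFn_truncPowL2 q w))

lemma norm_truncPowL2_sub_le (hq : 2 ≤ q) (hv : v ∈ Icc (0 : ℝ) 1) (hw : w ∈ Icc (0 : ℝ) 1) :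
    ‖truncPowL2 q v - truncPowL2 q w‖ ≤ q * |v - w| :=
  norm_le_of_forall_mem_Ico (coeFn_truncPowL2_sub q v w) (by positivity)
    fun _ hu => abs_truncPow_sub_le hq hv hw hu.2.le

lemma abs_truncPow_one_sub_le (v w u : ℝ) :
    |truncPow 1 v u - truncPow 1 w u| ≤ (uIcc v w).indicator 1 u := by
  by_cases hu : u ∈ uIcc v w
  · rw [indicator_of_mem hu]
    unfold truncPow
    split_ifs <;> simp
  · rw [mem_uIcc] at hu
    have h_iff : v ≤ u ↔ w ≤ u := by grind
    simp [truncPow, h_iff, indicator_apply_nonneg]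

lemma norm_truncPowL2_one_sub_sq_le (v w : ℝ) :
    ‖truncPowL2 1 v - truncPowL2 1 w‖ ^ 2 ≤ |v - w| := by
  have h := norm_sq_le_of_abs_le_indicator_Icc (c := 1) (coeFn_truncPowL2_sub 1 v w) min_le_max
    fun u _ => abs_truncPow_one_sub_le v w u
  rwa [max_sub_min_eq_abs, one_pow, one_mul, abs_sub_comm] at h

lemma norm_truncPowL2_sub_sq_le (hq : 1 ≤ q) (hv : v ∈ Icc (0 : ℝ) 1) (hw : w ∈ Icc (0 : ℝ) 1) :
    ‖truncPowL2 q v - truncPowL2 q w‖ ^ 2 ≤ q * |v - w| := by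
  rcases hq.eq_or_lt with rfl | hq
  · simpa using norm_truncPowL2_one_sub_sq_le v w
  · have h_le_one : ‖truncPowL2 q v - truncPowL2 q w‖ ≤ 1 := by
      refine norm_le_of_forall_mem_Ico (coeFn_truncPowL2_sub q v w) zero_le_one fun u hu => ?_
      rw [← sub_zero 1]
      exact abs_sub_le_of_le_of_le (truncPow_nonneg q v u)
        (le_of_abs_le (abs_truncPow_le_one q hv hu.2.le)) (truncPow_nonneg q w u)
        (le_of_abs_le (abs_truncPow_le_one q hw hu.2.le))
    rw [sq]
    exact (mul_le_of_le_one_left (norm_nonneg _) h_le_one).trans (norm_truncPowL2_sub_le hq hv hw)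

lemma norm_tensorPowL2_sub_le (hq : 1 ≤ q) {d : ℕ} {v w : Fin d → ℝ}
    (hv : v ∈ Icc (0 : Fin d → ℝ) 1) (hw : w ∈ Icc (0 : Fin d → ℝ) 1) :
    ‖tensorPowL2 q v - tensorPowL2 q w‖ ≤ d * √(q * dist v w) := by
  have h_norm : ∀ x ∈ Icc (0 : Fin d → ℝ) 1, ‖fun k => truncPowL2 q (x k)‖ ≤ 1 := fun x hx =>
    (pi_norm_le_iff_of_nonneg zero_le_one).2 fun k => norm_truncPowL2_le_one q ⟨hx.1 k, hx.2 k⟩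
  have h_sub : ‖(fun k => truncPowL2 q (v k)) - fun k => truncPowL2 q (w k)‖ ≤
      √(q * dist v w) := by
    refine (pi_norm_le_iff_of_nonneg (Real.sqrt_nonneg _)).2 fun k => Real.le_sqrt_of_sq_le ?_
    refine (norm_truncPowL2_sub_sq_le hq ⟨hv.1 k, hv.2 k⟩ ⟨hw.1 k, hw.2 k⟩).trans ?_
    gcongr
    exact dist_le_pi_dist v w k
  calc ‖tensorPowL2 q v - tensorPowL2 q w‖
      ≤ 1 * Fintype.card (Fin d) * max ‖fun k => truncPowL2 q (v k)‖ ‖fun k => truncPowL2 q (w k)‖ ^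
          (Fintype.card (Fin d) - 1) *
          ‖(fun k => truncPowL2 q (v k)) - fun k => truncPowL2 q (w k)‖ :=
        MultilinearMap.norm_image_sub_le_of_bound _ zero_le_one
          (fun f => by rw [norm_tensorL2, one_mul]) _ _
    _ ≤ 1 * Fintype.card (Fin d) * 1 * √(q * dist v w) := by
        gcongr
        exact pow_le_one₀ (le_max_of_le_left (norm_nonneg _)) (max_le (h_norm v hv) (h_norm w hw))
    _ = d * √(q * dist v w) := by simp

lemma continuousOn_tensorPowL2 (hq : 1 ≤ q) (d : ℕ) :
    ContinuousOn (tensorPowL2 q) (Icc (0 : Fin d → ℝ) 1) := by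
  intro w hw
  refine tendsto_iff_norm_sub_tendsto_zero.2 (squeeze_zero' (.of_forall fun _ => norm_nonneg _)
    (eventually_nhdsWithin_of_forall fun v hv => norm_tensorPowL2_sub_le hq hv hw) ?_)
  have h_cont : Continuous fun v : Fin d → ℝ => d * √(q * dist v w) := by fun_prop
  simpa using (h_cont.tendsto w).mono_left nhdsWithin_le_nhds

end TruncPowModulus

section GridCovers

lemma coveringNumber_image_le_of_dist {X Y : Type*} [PseudoMetricSpace X] [PseudoMetricSpace Y]
    {f : X → Y} {T : Set X} {δ ε : ℝ≥0}
    (h : ∀ x ∈ T, ∀ y ∈ T, dist x y ≤ δ → dist (f x) (f y) ≤ ε) :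
    Metric.coveringNumber ε (f '' T) ≤ Metric.coveringNumber δ T := by
  refine le_iInf₂ fun C hCT => le_iInf fun hC => ?_
  refine (Metric.IsCover.coveringNumber_le_encard (image_mono hCT) ?_).trans (encard_image_le f C)
  rintro _ ⟨x, hx, rfl⟩
  obtain ⟨y, hy, hxy⟩ := hC hx
  refine ⟨f y, mem_image_of_mem f hy, edist_le_coe.2 (h x hx y (hCT hy) ?_)⟩
  exact edist_le_coe.1 hxy

lemma coveringNumber_univ_pi_le {ι : Type*} [Fintype ι] {X : ι → Type*}
    [∀ i, PseudoMetricSpace (X i)] {ε : ℝ≥0} {T : ∀ i, Set (X i)} {N : ι → ℕ}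
    (h : ∀ i, Metric.coveringNumber ε (T i) ≤ N i) :
    Metric.coveringNumber ε (univ.pi T) ≤ ((∏ i, N i : ℕ) : ℕ∞) := by
  choose C hCT _ hC hCN using fun i =>
    Metric.exists_set_encard_eq_coveringNumber ((h i).trans_lt (ENat.natCast_lt_top _)).ne
  refine (Metric.IsCover.coveringNumber_le_encard (C := univ.pi C)
    (pi_mono fun i _ => hCT i) fun x hx => ?_).trans ?_
  · choose y hy hxy using fun i => hC i (hx i (mem_univ i))
    exact ⟨y, fun i _ => hy i, edist_pi_le_iff.2 hxy⟩
  · rw [encard_pi_eq_prod_encard, Nat.cast_prod]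
    exact Finset.prod_le_prod' fun i _ => (hCN i).trans_le (h i)

lemma coveringNumber_Icc_le {N : ℕ} (hN : 0 < N) :
    Metric.coveringNumber (1 / N) (Icc (0 : ℝ) 1) ≤ ((N + 1 : ℕ) : ℕ∞) := by
  have hN' : (0 : ℝ) < N := by exact_mod_cast hN
  refine (Metric.IsCover.coveringNumber_le_encard
    (C := (fun i : ℕ => (i / N : ℝ)) '' Finset.range (N + 1)) ?_ fun t ht => ?_).trans
    ((encard_image_le _ _).trans ?_)
  · rintro _ ⟨i, hi, rfl⟩
    have hi : (i : ℝ) ≤ N := by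
      exact_mod_cast Nat.lt_succ_iff.1 (Finset.mem_range.1 (Finset.mem_coe.1 hi))
    exact ⟨by positivity, (div_le_one hN').2 hi⟩
  · have h_floor_le := Nat.floor_le (mul_nonneg hN'.le ht.1)
    have h_lt_floor := Nat.lt_floor_add_one (N * t)
    have h_floor_le_N : ⌊N * t⌋₊ ≤ N :=
      Nat.floor_le_of_le (mul_le_of_le_one_right hN'.le ht.2)
    refine ⟨_, mem_image_of_mem _ (Finset.mem_coe.2
      (Finset.mem_range.2 (Nat.lt_succ_of_le h_floor_le_N))), edist_le_coe.2 ?_⟩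
    rw [← NNReal.coe_le_coe, coe_nndist, Real.dist_eq]
    have h_sub : t - ⌊N * t⌋₊ / N = (N * t - ⌊N * t⌋₊) / N := by field_simp
    rw [h_sub, abs_of_nonneg (div_nonneg (by linarith) hN'.le)]
    push_cast
    gcongr
    linarith
  · rw [encard_coe_eq_coe_finsetCard, Finset.card_range]

lemma coveringNumber_Icc_pi_le (d : ℕ) {N : ℕ} (hN : 0 < N) :
    Metric.coveringNumber (1 / N) (Icc (0 : Fin d → ℝ) 1) ≤ (((N + 1) ^ d : ℕ) : ℕ∞) := by
  rw [← pi_univ_Icc]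
  simpa using coveringNumber_univ_pi_le fun _ : Fin d => coveringNumber_Icc_le hN

lemma coveringNumber_tensorPowL2_image_le {q : ℕ} (hq : 1 ≤ q) (d n : ℕ) :
    Metric.coveringNumber (1 / 2 ^ n) (tensorPowL2 q '' Icc (0 : Fin d → ℝ) 1) ≤
      ((2 ^ ((2 * n + d ^ 2 * q + 1) * d) : ℕ) : ℕ∞) := by
  set m := 2 * n + d ^ 2 * q with hm
  calc Metric.coveringNumber (1 / 2 ^ n) (tensorPowL2 q '' Icc (0 : Fin d → ℝ) 1)
      ≤ Metric.coveringNumber (1 / (2 ^ m : ℕ)) (Icc (0 : Fin d → ℝ) 1) := by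
        refine coveringNumber_image_le_of_dist fun v hv w hw hvw => ?_
        rw [dist_eq_norm]
        refine (norm_tensorPowL2_sub_le hq hv hw).trans ?_
        refine (sq_le_sq₀ (by positivity) (by positivity)).1 ?_
        rw [mul_pow, Real.sq_sqrt (by positivity)]
        calc (d : ℝ) ^ 2 * (q * dist v w) ≤ d ^ 2 * (q * (1 / 2 ^ m)) := by
              gcongr
              simpa using hvw
          _ = ((d ^ 2 * q : ℕ) : ℝ) / 2 ^ m := by push_cast; ring
          _ ≤ 2 ^ (d ^ 2 * q) / 2 ^ m := by
              gcongr
              exact_mod_cast Nat.lt_two_pow_self.le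
          _ = ((1 / 2 ^ n : ℝ≥0) : ℝ) ^ 2 := by
              rw [hm, pow_add, div_mul_cancel_right₀ (by positivity), mul_comm 2 n, pow_mul]
              simp
    _ ≤ (((2 ^ m + 1) ^ d : ℕ) : ℕ∞) := coveringNumber_Icc_pi_le d (by positivity)
    _ ≤ ((2 ^ ((m + 1) * d) : ℕ) : ℕ∞) := by
        rw [pow_mul, Nat.cast_le]
        gcongr
        rw [pow_succ, mul_two]
        exact Nat.add_le_add_left Nat.one_le_two_pow _

lemma coveringNumber_truncPowClass_le {q N : ℕ} (hN : 0 < N) {ε : ℝ} (hε : 0 ≤ ε)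
    (h : ∀ v ∈ Icc (0 : ℝ) 1, ∀ w ∈ Icc (0 : ℝ) 1, |v - w| ≤ 1 / N →
      ‖truncPowL2 q v - truncPowL2 q w‖ ≤ ε) :
    (Metric.coveringNumber ε.toNNReal (truncPowClass q) : ℝ≥0∞) ≤ ENNReal.ofReal (N + 1) := by
  rw [truncPowClass_eq_image]
  calc (Metric.coveringNumber ε.toNNReal (truncPowL2 q '' Icc 0 1) : ℝ≥0∞)
      ≤ ((N + 1 : ℕ) : ℕ∞) := by
        refine ENat.toENNReal_mono ((coveringNumber_image_le_of_dist (δ := 1 / N)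
          fun v hv w hw hvw => ?_).trans (coveringNumber_Icc_le hN))
        rw [dist_eq_norm, Real.coe_toNNReal _ hε]
        exact h v hv w hw (by simpa [Real.dist_eq] using hvw)
    _ = ENNReal.ofReal (N + 1) := by
        rw [ENat.toENNReal_coe, ← ENNReal.ofReal_natCast, Nat.cast_succ]

lemma coveringNumber_truncPowClass_of_two_le {q : ℕ} (hq : 2 ≤ q) :
    ∃ C : ℝ, ∀ᶠ ε : ℝ in 𝓝[>] 0,
      (Metric.coveringNumber ε.toNNReal (truncPowClass q) : ℝ≥0∞) ≤
        ENNReal.ofReal (C * (1 / ε)) := by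
  refine ⟨q + 2, ?_⟩
  filter_upwards [Ioo_mem_nhdsGT zero_lt_one] with ε ⟨hε, hε_lt_one⟩
  have hN : 0 < q / ε := div_pos (by exact_mod_cast (by omega : 0 < q)) hε
  refine (coveringNumber_truncPowClass_le (N := ⌈q / ε⌉₊) (Nat.ceil_pos.2 hN) hε.le
    fun v hv w hw hvw => ?_).trans (ENNReal.ofReal_le_ofReal ?_)
  · calc ‖truncPowL2 q v - truncPowL2 q w‖ ≤ q * |v - w| := norm_truncPowL2_sub_le hq hv hw
      _ ≤ q * (1 / (q / ε)) := by
          gcongr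
          exact hvw.trans (one_div_le_one_div_of_le hN (Nat.le_ceil _))
      _ = ε := by field_simp
  · have h_ceil := Nat.ceil_lt_add_one hN.le
    have h_one_le : 1 ≤ 1 / ε := one_le_one_div hε hε_lt_one.le
    have h_split : ((q : ℝ) + 2) * (1 / ε) = q / ε + 2 * (1 / ε) := by ring
    linarith

lemma coveringNumber_truncPowClass_one :
    ∃ C : ℝ, ∀ᶠ ε : ℝ in 𝓝[>] 0,
      (Metric.coveringNumber ε.toNNReal (truncPowClass 1) : ℝ≥0∞) ≤
        ENNReal.ofReal (C * (1 / ε) ^ 2) := by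
  refine ⟨3, ?_⟩
  filter_upwards [Ioo_mem_nhdsGT zero_lt_one] with ε ⟨hε, hε_lt_one⟩
  have hN : 0 < (1 / ε) ^ 2 := by positivity
  refine (coveringNumber_truncPowClass_le (N := ⌈(1 / ε) ^ 2⌉₊) (Nat.ceil_pos.2 hN) hε.le
    fun v _ w _ hvw => ?_).trans (ENNReal.ofReal_le_ofReal ?_)
  · refine (sq_le_sq₀ (norm_nonneg _) hε.le).1 ?_
    calc ‖truncPowL2 1 v - truncPowL2 1 w‖ ^ 2 ≤ |v - w| := norm_truncPowL2_one_sub_sq_le v w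
      _ ≤ 1 / (1 / ε) ^ 2 := hvw.trans (one_div_le_one_div_of_le hN (Nat.le_ceil _))
      _ = ε ^ 2 := by field_simp
  · have h_ceil := Nat.ceil_lt_add_one hN.le
    have h_one_le : 1 ≤ (1 / ε) ^ 2 := one_le_pow₀ (one_le_one_div hε hε_lt_one.le)
    linarith

end GridCovers

section DyadicShells

/-- The half-open dyadic interval of length `2⁻ʲ` that contains `v ≥ 0`. (On negative reals the
natural floor is `0`, so the first interval also contains these.) -/
def dyadicInterval (v : ℝ) (j : ℕ) : Set ℝ := {u | ⌊2 ^ j * u⌋₊ = ⌊2 ^ j * v⌋₊}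

/-- The points that leave the dyadic intervals around `v` after level `j`. The decomposition of
the unit interval into these shells is cut off at level `n + 1`, where the shell is the whole
interval. -/
def dyadicShell (n : ℕ) (v : ℝ) (j : ℕ) : Set ℝ :=
  {u ∈ dyadicInterval v j | j ≤ n → u ∉ dyadicInterval v (j + 1)}

variable {n i j : ℕ} {u v : ℝ}

lemma floor_two_pow_mul_eq_div (u : ℝ) (hij : i ≤ j) :
    ⌊2 ^ i * u⌋₊ = ⌊2 ^ j * u⌋₊ / 2 ^ (j - i) := by
  rw [← Nat.floor_div_natCast]
  congr 1
  push_cast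
  rw [eq_div_iff (by positivity), mul_right_comm, ← pow_add, Nat.add_sub_cancel' hij]

lemma dyadicInterval_antitone (v : ℝ) : Antitone (dyadicInterval v) := fun i j hij u hu => by
  rw [dyadicInterval, mem_ofPred_eq] at hu ⊢
  rw [floor_two_pow_mul_eq_div u hij, floor_two_pow_mul_eq_div v hij, hu]

lemma mem_dyadicInterval_zero (hu : u ∈ Ico (0 : ℝ) 1) (hv : v ∈ Ico (0 : ℝ) 1) :
    u ∈ dyadicInterval v 0 := by
  rw [dyadicInterval, mem_ofPred_eq, pow_zero, one_mul, one_mul,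
    Nat.floor_eq_zero.2 hu.2, Nat.floor_eq_zero.2 hv.2]

lemma sub_le_of_mem_dyadicInterval (hv : 0 ≤ v) (hu : u ∈ dyadicInterval v j) :
    u - v ≤ 1 / 2 ^ j := by
  have h_lt := Nat.lt_floor_add_one ((2 : ℝ) ^ j * u)
  have h_le := Nat.floor_le (show 0 ≤ (2 : ℝ) ^ j * v by positivity)
  rw [show ⌊2 ^ j * u⌋₊ = ⌊2 ^ j * v⌋₊ from hu] at h_lt
  rw [le_div_iff₀ (by positivity)]
  linarith

lemma measurableSet_floor_two_pow_mul_eq (j m : ℕ) :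
    MeasurableSet {u : ℝ | ⌊2 ^ j * u⌋₊ = m} :=
  (Nat.measurable_floor.comp (measurable_id.const_mul ((2 : ℝ) ^ j))) (measurableSet_singleton m)

lemma measurableSet_dyadicShell (n : ℕ) (v : ℝ) (j : ℕ) : MeasurableSet (dyadicShell n v j) := by
  have h : ∀ i, MeasurableSet (dyadicInterval v i) := fun i =>
    measurableSet_floor_two_pow_mul_eq i _
  exact (h j).inter ((MeasurableSet.const (j ≤ n)).imp (h (j + 1)).compl)

lemma disjoint_dyadicShell (hij : i < j) (hj : j ≤ n + 1) :
    Disjoint (dyadicShell n v i) (dyadicShell n v j) :=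
  disjoint_left.2 fun _ hi hj' => hi.2 (by omega) (dyadicInterval_antitone v hij hj'.1)

lemma sum_indicator_dyadicShell {M : Type*} [AddCommGroup M] (n : ℕ) (f : ℝ → M)
    (hu : u ∈ dyadicInterval v 0) :
    ∑ j ∈ Finset.range (n + 2), (dyadicShell n v j).indicator f u = f u := by
  have h_sub : ∀ j ∈ Finset.range (n + 1), (dyadicShell n v j).indicator f u =
      (dyadicInterval v j).indicator f u - (dyadicInterval v (j + 1)).indicator f u :=
    fun j hj => by
      have h_anti := dyadicInterval_antitone v j.le_succ
      have h_diff : dyadicShell n v j = dyadicInterval v j \ dyadicInterval v (j + 1) := by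
        ext; simp [dyadicShell, Nat.lt_succ_iff.1 (Finset.mem_range.1 hj)]
      rw [h_diff, indicator_sdiff h_anti, Pi.sub_apply]
  have h_last : dyadicShell n v (n + 1) = dyadicInterval v (n + 1) := by
    ext; simp [dyadicShell]
  rw [Finset.sum_range_succ, Finset.sum_congr rfl h_sub, Finset.sum_range_sub', h_last,
    sub_add_cancel, indicator_of_mem hu]

lemma mem_dyadicShell_and_le_iff (hj : j ≤ n) : u ∈ dyadicShell n v j ∧ v ≤ u ↔
    ⌊2 ^ (j + 1) * u⌋₊ / 2 = ⌊2 ^ (j + 1) * v⌋₊ / 2 ∧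
      ⌊2 ^ (j + 1) * v⌋₊ < ⌊2 ^ (j + 1) * u⌋₊ := by
  have h_half : ∀ x : ℝ, ⌊2 ^ j * x⌋₊ = ⌊2 ^ (j + 1) * x⌋₊ / 2 := fun x => by
    simpa using floor_two_pow_mul_eq_div x j.le_succ
  simp only [dyadicShell, dyadicInterval, mem_ofPred_eq, h_half]
  constructor
  · rintro ⟨⟨h_eq, h_ne⟩, hvu⟩
    exact ⟨h_eq, lt_of_le_of_ne (Nat.floor_mono (by gcongr)) (Ne.symm (h_ne hj))⟩
  · rintro ⟨h_eq, h_lt⟩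
    refine ⟨⟨h_eq, fun _ => h_lt.ne'⟩, le_of_not_gt fun huv => h_lt.not_ge ?_⟩
    exact Nat.floor_mono (by gcongr)

end DyadicShells

section Layers

/-- The restriction of `ψ_v` to the `j`-th dyadic shell around `v`. -/
noncomputable def layerL2 (q n : ℕ) (v : ℝ) (j : ℕ) : Lp ℝ 2 unitMeasure :=
  ((memLp_truncPow q v).indicator (measurableSet_dyadicShell n v j)).toLp _

variable {q n j : ℕ} {v : ℝ}

lemma coeFn_layerL2 (q n : ℕ) (v : ℝ) (j : ℕ) :
    layerL2 q n v j =ᵐ[unitMeasure] (dyadicShell n v j).indicator (truncPow q v) :=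
  MemLp.coeFn_toLp _

lemma sum_layerL2 (q n : ℕ) (hv : v ∈ Icc (0 : ℝ) 1) :
    ∑ j ∈ Finset.range (n + 2), layerL2 q n v j = truncPowL2 q v := by
  have h_sum := coeFn_sum_smul (s := Finset.range (n + 2)) (fun j _ => coeFn_layerL2 q n v j) 1
  simp only [Pi.one_apply, one_smul, one_mul] at h_sum
  refine Lp.ext (h_sum.trans (EventuallyEq.trans ?_ (coeFn_truncPowL2 q v).symm))
  filter_upwards [ae_unitMeasure_mem_Ico] with u hu
  rcases hv.2.lt_or_eq with hv_lt | rfl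
  · exact sum_indicator_dyadicShell n _ (mem_dyadicInterval_zero hu ⟨hv.1, hv_lt⟩)
  · have h_zero : truncPow q 1 u = 0 := if_neg (not_le.2 hu.2)
    rw [h_zero]
    exact Finset.sum_eq_zero fun j _ => indicator_apply_eq_zero.2 fun _ => h_zero

lemma inner_layerL2_eq_zero (q : ℕ) (v : ℝ) {i j : ℕ} (hij : i ≠ j) (hi : i ≤ n + 1)
    (hj : j ≤ n + 1) : inner ℝ (layerL2 q n v i) (layerL2 q n v j) = 0 := by
  wlog h_lt : i < j generalizing i j
  · rw [real_inner_comm]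
    exact this hij.symm hj hi (by omega)
  rw [L2.inner_def]
  refine integral_eq_zero_of_ae ?_
  filter_upwards [coeFn_layerL2 q n v i, coeFn_layerL2 q n v j] with u hui huj
  rw [hui, huj]
  by_cases hu : u ∈ dyadicShell n v i
  · simp [indicator_of_notMem ((disjoint_dyadicShell h_lt hj).notMem_of_mem_left hu)]
  · simp [indicator_of_notMem hu]

lemma norm_layerL2_sq_le (hq : 1 ≤ q) (hv : 0 ≤ v) (n j : ℕ) :
    ‖layerL2 q n v j‖ ^ 2 ≤ (1 / 2 ^ (2 * q - 1)) ^ j := by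
  have h_le : ∀ u, |(dyadicShell n v j).indicator (truncPow q v) u| ≤
      (Icc v (v + 1 / 2 ^ j)).indicator (fun _ => (1 / 2 ^ j) ^ (q - 1)) u := fun u => by
    have h_nonneg : 0 ≤ (Icc v (v + 1 / 2 ^ j)).indicator
        (fun _ => (1 / 2 ^ j : ℝ) ^ (q - 1)) u := indicator_nonneg (fun _ _ => by positivity) u
    by_cases hu : u ∈ dyadicShell n v j ∧ v ≤ u
    · have h_sub := sub_le_of_mem_dyadicInterval hv hu.1.1
      rw [indicator_of_mem hu.1, abs_of_nonneg (truncPow_nonneg q v u), truncPow, if_pos hu.2,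
        indicator_of_mem (show u ∈ Icc v (v + 1 / 2 ^ j) from ⟨hu.2, by linarith⟩)]
      exact pow_le_pow_left₀ (sub_nonneg.2 hu.2) h_sub _
    · have h_zero : (dyadicShell n v j).indicator (truncPow q v) u = 0 :=
        indicator_apply_eq_zero.2 fun h_mem => if_neg fun hvu => hu ⟨h_mem, hvu⟩
      rwa [h_zero, abs_zero]
  refine (norm_sq_le_of_abs_le_indicator_Icc (coeFn_layerL2 q n v j)
    (le_add_of_nonneg_right (by positivity)) fun u _ => h_le u).trans_eq ?_
  rw [add_sub_cancel_left, ← pow_mul, ← pow_succ, show (q - 1) * 2 + 1 = 2 * q - 1 by omega,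
    one_div_pow, one_div_pow, ← pow_mul, ← pow_mul, mul_comm]

end Layers

section LocalMonomials

/-- The function `u ↦ u ^ p` on the `i`-th dyadic interval of length `2⁻ʲ`, where `x = (i, p)`. -/
noncomputable def localMonomial (j : ℕ) (x : ℕ × ℕ) : ℝ → ℝ :=
  {u | ⌊2 ^ j * u⌋₊ = x.1}.indicator (· ^ x.2)

lemma memLp_localMonomial (j : ℕ) (x : ℕ × ℕ) : MemLp (localMonomial j x) 2 unitMeasure := by
  refine MemLp.indicator (measurableSet_floor_two_pow_mul_eq j x.1)
    (.of_bound (by fun_prop) 1 ?_)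
  filter_upwards [ae_unitMeasure_mem_Ico] with u hu
  rw [norm_pow, Real.norm_of_nonneg hu.1]
  exact pow_le_one₀ hu.1 hu.2.le

/-- The local monomials as elements of `L²[0, 1]`. -/
noncomputable def localMonomialL2 (j : ℕ) (x : ℕ × ℕ) : Lp ℝ 2 unitMeasure :=
  (memLp_localMonomial j x).toLp _

lemma sum_range_localMonomial {j : ℕ} {u : ℝ} (hu : u ∈ Ico (0 : ℝ) 1) (q : ℕ)
    (c : ℕ × ℕ → ℝ) :
    ∑ x ∈ Finset.range (2 ^ j) ×ˢ Finset.range q, c x * localMonomial j x u =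
      ∑ p ∈ Finset.range q, c (⌊2 ^ j * u⌋₊, p) * u ^ p := by
  have h_floor_lt : ⌊2 ^ j * u⌋₊ < 2 ^ j := by
    rw [Nat.floor_lt (mul_nonneg (by positivity) hu.1)]
    push_cast
    exact mul_lt_of_lt_one_right (by positivity) hu.2
  rw [Finset.sum_product, Finset.sum_eq_single_of_mem _ (Finset.mem_range.2 h_floor_lt)]
  · simp [localMonomial]
  · intro i _ hi
    refine Finset.sum_eq_zero fun p _ => ?_
    rw [localMonomial, indicator_of_notMem fun h => hi h.symm, mul_zero]

lemma exists_layerL2_eq_sum_smul_localMonomialL2 {q n j : ℕ} (hq : 1 ≤ q) (hj : j ≤ n) (v : ℝ) :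
    ∃ c : ℕ × ℕ → ℝ, layerL2 q n v j =
      ∑ x ∈ Finset.range (2 ^ (j + 1)) ×ˢ Finset.range q, c x • localMonomialL2 (j + 1) x := by
  classical
  set m := ⌊2 ^ (j + 1) * v⌋₊ with hm
  refine ⟨fun x => if x.1 / 2 = m / 2 ∧ m < x.1 then
    (-v) ^ (q - 1 - x.2) * (q - 1).choose x.2 else 0, Lp.ext ?_⟩
  refine ((coeFn_layerL2 q n v j).trans ?_).trans
    (coeFn_sum_smul (fun x _ => (memLp_localMonomial (j + 1) x).coeFn_toLp) _).symm
  filter_upwards [ae_unitMeasure_mem_Ico] with u hu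
  rw [sum_range_localMonomial hu, indicator_apply, truncPow, ← ite_and,
    if_congr (mem_dyadicShell_and_le_iff hj) rfl rfl, ← hm]
  split_ifs
  · rw [sub_eq_add_neg, add_pow, Nat.sub_add_cancel hq]
    exact Finset.sum_congr rfl fun p _ => by ring
  · simp

end LocalMonomials

section Counting

lemma sum_piFinset_le {M : Type*} [AddCommMonoid M] (D : ℕ) (s : Finset M) (f : M → ℝ) {b : ℝ}
    (hb : ∀ m, ∑ a ∈ s, f (a + m) ≤ b) :
    ∑ j ∈ Fintype.piFinset (fun _ : Fin (D + 1) => s), f (∑ k, j k) ≤ s.card ^ D * b := by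
  have h_split : ∑ j ∈ Fintype.piFinset (fun _ : Fin (D + 1) => s), f (∑ k, j k) =
      ∑ x ∈ Fintype.piFinset (fun _ : Fin D => s) ×ˢ s, f (x.2 + ∑ k, x.1 k) := by
    refine (Finset.sum_bij' (fun x _ => (Fin.cons x.2 x.1 : Fin (D + 1) → M))
      (fun j _ => (Fin.tail j, j 0)) ?_ ?_ ?_ ?_ ?_).symm
    · rintro ⟨x, a⟩ h
      simp only [Finset.mem_product, Fintype.mem_piFinset] at h ⊢
      exact Fin.cases (by simpa using h.2) (by simpa using h.1)
    · intro j h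
      simp only [Finset.mem_product, Fintype.mem_piFinset] at h ⊢
      exact ⟨fun k => h k.succ, h 0⟩
    · rintro ⟨x, a⟩ _; simp
    · intro j _; simp
    · rintro ⟨x, a⟩ _; simp [Fin.sum_univ_succ]
  rw [h_split, Finset.sum_product]
  refine (Finset.sum_le_sum fun x _ => hb _).trans_eq ?_
  rw [Finset.sum_const, Fintype.card_piFinset_const, nsmul_eq_mul, Nat.cast_pow]

lemma sum_range_two_pow_le (n N s : ℕ) :
    ∑ a ∈ Finset.range N, (if a + s ≤ n then (2 : ℝ) ^ (a + s) else 0) ≤ 2 ^ (n + 1) := by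
  calc ∑ a ∈ Finset.range N, (if a + s ≤ n then (2 : ℝ) ^ (a + s) else 0)
      ≤ ∑ m ∈ Finset.range (n + 1), (2 : ℝ) ^ m := by
        rw [← Finset.sum_filter, ← Finset.sum_image (f := fun m => (2 : ℝ) ^ m)
          (g := fun a => a + s) (add_left_injective s).injOn]
        refine Finset.sum_le_sum_of_subset_of_nonneg (fun m hm => ?_) fun _ _ _ => by positivity
        simp only [Finset.mem_image, Finset.mem_filter, Finset.mem_range] at hm ⊢
        omega
    _ ≤ 2 ^ (n + 1) := by
        rw [geom_sum_eq (by norm_num)]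
        norm_num

lemma sum_range_pow_tail_le {c : ℝ} (hc₀ : 0 ≤ c) (hc : c ≤ 1 / 2) (n N s : ℕ) :
    ∑ a ∈ Finset.range N, (if a + s ≤ n then 0 else c ^ (a + s)) ≤ 2 * c ^ (n + 1) := by
  calc ∑ a ∈ Finset.range N, (if a + s ≤ n then 0 else c ^ (a + s))
      ≤ ∑ m ∈ Finset.Ico (n + 1) (N + s + n + 1), c ^ m := by
        simp only [← ite_not (p := _ ≤ n)]
        rw [← Finset.sum_filter, ← Finset.sum_image (f := fun m => c ^ m)
          (g := fun a => a + s) (add_left_injective s).injOn]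
        refine Finset.sum_le_sum_of_subset_of_nonneg (fun m hm => ?_) fun _ _ _ => by positivity
        simp only [Finset.mem_image, Finset.mem_filter, Finset.mem_range, Finset.mem_Ico] at hm ⊢
        omega
    _ ≤ c ^ (n + 1) / (1 - c) := geom_sum_Ico_le_of_lt_one hc₀ (by linarith)
    _ ≤ 2 * c ^ (n + 1) := by
        rw [div_le_iff₀ (by linarith)]
        nlinarith [pow_nonneg hc₀ (n + 1)]

lemma cast_add_two_pow_le (n D : ℕ) : ((n + 2 : ℕ) : ℝ) ^ D ≤ 2 ^ D * (n + 1) ^ D := by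
  rw [← mul_pow]
  refine pow_le_pow_left₀ (by positivity) ?_ D
  push_cast
  linarith [(n.cast_nonneg : (0 : ℝ) ≤ n)]

end Counting

section HyperbolicCross

variable {q d n : ℕ}

/-- Indices `(j, x)` of the tensor products of local monomials of total level `∑ k, j k ≤ n`: on
the `k`-th axis, `j k` is the level of the shell and `x k` the local monomial. -/
def monomialIndex (q d n : ℕ) : Finset ((_ : Fin d → ℕ) × (Fin d → ℕ × ℕ)) :=
  ((Fintype.piFinset fun _ : Fin d => Finset.range (n + 2)).filter fun j => ∑ k, j k ≤ n).sigma
    fun j => Fintype.piFinset fun k => Finset.range (2 ^ (j k + 1)) ×ˢ Finset.range q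

lemma card_monomialIndex (q d n : ℕ) : ((monomialIndex q d n).card : ℝ) =
    (2 * q) ^ d * ∑ j ∈ Fintype.piFinset (fun _ : Fin d => Finset.range (n + 2)),
      (if ∑ k, j k ≤ n then (2 : ℝ) ^ (∑ k, j k) else 0) := by
  rw [monomialIndex, Finset.card_sigma, ← Finset.sum_filter, Finset.mul_sum, Nat.cast_sum]
  refine Finset.sum_congr rfl fun j _ => ?_
  simp only [Fintype.card_piFinset, Finset.card_product, Finset.card_range, pow_succ]
  push_cast
  rw [Finset.prod_mul_distrib, Finset.prod_mul_distrib, Finset.prod_pow_eq_pow_sum]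
  simp only [Finset.prod_const, Finset.card_univ, Fintype.card_fin]
  ring

lemma card_monomialIndex_le (q D n : ℕ) :
    (monomialIndex q (D + 1) n).card ≤ 2 ^ (2 * D + 2) * q ^ (D + 1) * dyadicCount D n := by
  have h_sum := sum_piFinset_le D (Finset.range (n + 2)) (fun m => if m ≤ n then (2 : ℝ) ^ m else 0)
    (sum_range_two_pow_le n (n + 2))
  rw [Finset.card_range] at h_sum
  have h_card : ((monomialIndex q (D + 1) n).card : ℝ) ≤
      2 ^ (2 * D + 2) * q ^ (D + 1) * (2 ^ n * (n + 1) ^ D) := by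
    rw [card_monomialIndex]
    calc _ ≤ (2 * (q : ℝ)) ^ (D + 1) * ((2 ^ D * (n + 1) ^ D) * 2 ^ (n + 1)) := by
          refine mul_le_mul_of_nonneg_left (h_sum.trans ?_) (by positivity)
          gcongr
          exact cast_add_two_pow_le n D
      _ = _ := by rw [mul_pow]; ring
  exact_mod_cast h_card

/-- The span of the tensor products of local monomials of total level at most `n`. -/
noncomputable def hyperbolicCross (q d n : ℕ) : Submodule ℝ (L2Cube d) :=
  Submodule.span ℝ (Set.range fun x : monomialIndex q d n =>
    tensorL2 _ fun k => localMonomialL2 (x.1.1 k + 1) (x.1.2 k))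

instance finiteDimensional_hyperbolicCross (q d n : ℕ) :
    FiniteDimensional ℝ (hyperbolicCross q d n) :=
  FiniteDimensional.span_of_finite ℝ (Set.finite_range _)

lemma finrank_hyperbolicCross_le (q D n : ℕ) : Module.finrank ℝ (hyperbolicCross q (D + 1) n) ≤
    2 ^ (2 * D + 2) * q ^ (D + 1) * dyadicCount D n :=
  ((finrank_range_le_card _).trans_eq (Fintype.card_coe _)).trans (card_monomialIndex_le q D n)

lemma tensorL2_layerL2_mem_hyperbolicCross (hq : 1 ≤ q) (v : Fin d → ℝ) {j : Fin d → ℕ}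
    (hj : ∑ k, j k ≤ n) :
    tensorL2 _ (fun k => layerL2 q n (v k) (j k)) ∈ hyperbolicCross q d n := by
  have h_le : ∀ k, j k ≤ n := fun k =>
    (Finset.single_le_sum (fun _ _ => Nat.zero_le _) (Finset.mem_univ k)).trans hj
  choose c hc using fun k => exists_layerL2_eq_sum_smul_localMonomialL2 hq (h_le k) (v k)
  rw [funext hc, MultilinearMap.map_sum_finset]
  refine Submodule.sum_mem _ fun x hx => ?_
  rw [MultilinearMap.map_smul_univ]
  refine Submodule.smul_mem _ _ (Submodule.subset_span ⟨⟨⟨j, x⟩, ?_⟩, rfl⟩)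
  simp only [monomialIndex, Finset.mem_sigma, Finset.mem_filter]
  refine ⟨⟨Fintype.mem_piFinset.2 fun k => Finset.mem_range.2 ?_, hj⟩, hx⟩
  exact Nat.lt_succ_of_le ((h_le k).trans n.le_succ)

lemma sum_tensorL2_layerL2 (q n : ℕ) {v : Fin d → ℝ} (hv : v ∈ Icc 0 1) :
    ∑ j ∈ Fintype.piFinset fun _ : Fin d => Finset.range (n + 2),
      tensorL2 _ (fun k => layerL2 q n (v k) (j k)) = tensorPowL2 q v := by
  rw [tensorPowL2, ← MultilinearMap.map_sum_finset]
  exact congrArg _ (funext fun k => sum_layerL2 q n ⟨hv.1 k, hv.2 k⟩)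

lemma norm_sum_sq_of_pairwise_inner_eq_zero {ι E : Type*} [NormedAddCommGroup E]
    [InnerProductSpace ℝ E] {s : Finset ι} {x : ι → E}
    (h : (s : Set ι).Pairwise fun i j => inner ℝ (x i) (x j) = 0) :
    ‖∑ i ∈ s, x i‖ ^ 2 = ∑ i ∈ s, ‖x i‖ ^ 2 := by
  rw [← real_inner_self_eq_norm_sq, sum_inner]
  refine Finset.sum_congr rfl fun i hi => ?_
  rw [inner_sum, Finset.sum_eq_single_of_mem i hi fun j hj hji => h hi hj hji.symm,
    real_inner_self_eq_norm_sq]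

lemma norm_sum_tensorL2_layerL2_sq (q n : ℕ) (v : Fin d → ℝ) {s : Finset (Fin d → ℕ)}
    (hs : s ⊆ Fintype.piFinset fun _ => Finset.range (n + 2)) :
    ‖∑ j ∈ s, tensorL2 _ (fun k => layerL2 q n (v k) (j k))‖ ^ 2 =
      ∑ j ∈ s, ∏ k, ‖layerL2 q n (v k) (j k)‖ ^ 2 := by
  have h_le : ∀ j ∈ s, ∀ k, j k ≤ n + 1 := fun j hj k =>
    Nat.le_of_lt_succ (Finset.mem_range.1 (Fintype.mem_piFinset.1 (hs hj) k))
  rw [norm_sum_sq_of_pairwise_inner_eq_zero]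
  · simp only [norm_tensorL2, Finset.prod_pow]
  · intro i hi j hj hij
    obtain ⟨k, hk⟩ := Function.ne_iff.1 hij
    rw [inner_tensorL2]
    exact Finset.prod_eq_zero (Finset.mem_univ k)
      (inner_layerL2_eq_zero q (v k) hk (h_le i hi k) (h_le j hj k))

lemma sum_layers_tail_le (hq : 1 ≤ q) (D n : ℕ) {v : Fin (D + 1) → ℝ} (hv : 0 ≤ v) :
    ∑ j ∈ (Fintype.piFinset fun _ : Fin (D + 1) => Finset.range (n + 2)) with ¬ ∑ k, j k ≤ n,
      ∏ k, ‖layerL2 q n (v k) (j k)‖ ^ 2 ≤ 2 ^ (D + 1) * (n + 1) ^ D / 2 ^ (n * (2 * q - 1)) := by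
  set c : ℝ := 1 / 2 ^ (2 * q - 1) with hc
  have hc₀ : 0 ≤ c := by positivity
  have hc_half : c ≤ 1 / 2 :=
    one_div_le_one_div_of_le (by norm_num) (le_self_pow₀ (by norm_num) (by omega))
  have h_tail := sum_piFinset_le D (Finset.range (n + 2)) (fun m => if m ≤ n then 0 else c ^ m)
    (sum_range_pow_tail_le hc₀ hc_half n (n + 2))
  rw [Finset.card_range] at h_tail
  calc _ ≤ ∑ j ∈ (Fintype.piFinset fun _ : Fin (D + 1) => Finset.range (n + 2))
        with ¬ ∑ k, j k ≤ n, c ^ (∑ k, j k) := by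
        refine Finset.sum_le_sum fun j _ => ?_
        rw [← Finset.prod_pow_eq_pow_sum]
        exact Finset.prod_le_prod (fun k _ => sq_nonneg _)
          fun k _ => norm_layerL2_sq_le hq (hv k) n (j k)
    _ = ∑ j ∈ Fintype.piFinset fun _ : Fin (D + 1) => Finset.range (n + 2),
        (if ∑ k, j k ≤ n then 0 else c ^ (∑ k, j k)) := by
        simp only [Finset.sum_filter, ite_not]
    _ ≤ ((n + 2 : ℕ) : ℝ) ^ D * (2 * c ^ (n + 1)) := h_tail
    _ ≤ (2 ^ D * (n + 1) ^ D) * (2 * c ^ n) := by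
        gcongr ?_ * (2 * ?_)
        · exact cast_add_two_pow_le n D
        · exact pow_le_pow_of_le_one hc₀ (by linarith) n.le_succ
    _ = _ := by
        rw [hc, one_div_pow, ← pow_mul, mul_comm n, pow_succ]
        ring

lemma norm_starProjection_orthogonal_hyperbolicCross_sq_le (hq : 1 ≤ q) (D n : ℕ)
    {v : Fin (D + 1) → ℝ} (hv : v ∈ Icc 0 1) :
    ‖(hyperbolicCross q (D + 1) n)ᗮ.starProjection (tensorPowL2 q v)‖ ^ 2 ≤
      2 ^ (D + 1) * (n + 1) ^ D / 2 ^ (n * (2 * q - 1)) := by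
  set J := Fintype.piFinset fun _ : Fin (D + 1) => Finset.range (n + 2)
  set a := fun j : Fin (D + 1) → ℕ => tensorL2 (fun _ => unitMeasure)
    fun k => layerL2 q n (v k) (j k)
  have h_low : ∑ j ∈ J with ∑ k, j k ≤ n, a j ∈ hyperbolicCross q (D + 1) n :=
    Submodule.sum_mem _ fun j hj =>
      tensorL2_layerL2_mem_hyperbolicCross hq v (Finset.mem_filter.1 hj).2
  rw [← sum_tensorL2_layerL2 q n hv,
    ← Finset.sum_filter_add_sum_filter_not J (fun j => ∑ k, j k ≤ n), map_add,
    Submodule.starProjection_orthogonal_apply_eq_zero h_low, zero_add]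
  calc _ ≤ ‖∑ j ∈ J with ¬ ∑ k, j k ≤ n, a j‖ ^ 2 := by
        gcongr
        exact Submodule.norm_starProjection_apply_le _ _
    _ = _ := norm_sum_tensorL2_layerL2_sq q n v (Finset.filter_subset _ _)
    _ ≤ _ := sum_layers_tail_le hq D n hv.1

lemma hasDyadicCovers_absconvTensor (hq : 1 ≤ q) (hd : 1 ≤ d) :
    HasDyadicCovers q (d - 1) (absconvTensor q d) := by
  obtain ⟨D, rfl⟩ := Nat.exists_eq_add_of_le' hd
  rw [Nat.add_sub_cancel, absconvTensor_eq]
  set A := 2 ^ (2 * D + 2) * q ^ (D + 1) + (2 * q + (D + 1) ^ 2 * q + 1) * (D + 1)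
  have hA_two : 2 ^ (D + 1) ≤ A :=
    calc 2 ^ (D + 1) ≤ 2 ^ (2 * D + 2) := Nat.pow_le_pow_right two_pos (by omega)
      _ ≤ 2 ^ (2 * D + 2) * q ^ (D + 1) := Nat.le_mul_of_pos_right _ (by positivity)
      _ ≤ A := Nat.le_add_right _ _
  refine (hasDyadicCovers_absConvexHull (A := A) hq ?_ (fun n => ?_) fun n => ?_).closure
  · rintro _ ⟨v, hv, rfl⟩
    exact norm_tensorPowL2_le_one q hv
  · refine ⟨hyperbolicCross q (D + 1) n, inferInstance, ?_, ?_⟩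
    · exact (finrank_hyperbolicCross_le q D n).trans
        (Nat.mul_le_mul_right _ (Nat.le_add_right _ _))
    · rintro _ ⟨v, hv, rfl⟩
      push_cast
      refine Real.le_sqrt_of_sq_le
        ((norm_starProjection_orthogonal_hyperbolicCross_sq_le hq D n hv).trans ?_)
      gcongr
      exact_mod_cast hA_two
  · have h_net := coveringNumber_tensorPowL2_image_le hq (D + 1) (n * q)
    refine (Metric.externalCoveringNumber_le_coveringNumber _ _).trans (h_net.trans ?_)
    refine Nat.cast_le.2 (Nat.pow_le_pow_right two_pos ?_)
    calc (2 * (n * q) + (D + 1) ^ 2 * q + 1) * (D + 1)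
        ≤ (2 * q + (D + 1) ^ 2 * q + 1) * (D + 1) * (n + 1) := by
          rw [mul_right_comm]
          gcongr
          nlinarith [Nat.zero_le ((D + 1) ^ 2 * q * n)]
      _ ≤ A * (n + 1) := Nat.mul_le_mul_right _ (Nat.le_add_left _ _)

end HyperbolicCross

section OneVariable

lemma tsupport_iterate_deriv_subset (n : ℕ) (h : ℝ → ℝ) : tsupport (deriv^[n] h) ⊆ tsupport h := by
  induction n generalizing h with
  | zero => exact subset_rfl
  | succ n ih => exact (ih (deriv h)).trans tsupport_deriv_subset

lemma integral_sub_pow_mul_iterate_deriv {h : ℝ → ℝ} (hh : ContDiff ℝ (⊤ : ℕ∞) h) {b : ℝ}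
    (hb : b ∉ tsupport h) (v : ℝ) (m : ℕ) :
    ∫ u in v..b, (u - v) ^ m * (deriv^[m + 1] h) u = (-1) ^ (m + 1) * m.factorial * h v := by
  have h_end : ∀ n, (deriv^[n] h) b = 0 := fun n =>
    image_eq_zero_of_notMem_tsupport fun hc => hb (tsupport_iterate_deriv_subset n h hc)
  have h_deriv : ∀ n x, HasDerivAt (deriv^[n] h) ((deriv^[n + 1] h) x) x := fun n x => by
    rw [Function.iterate_succ_apply']
    exact ((hh.iterate_deriv n).differentiable (by simp) x).hasDerivAt
  have h_cont : ∀ n, Continuous (deriv^[n] h) := fun n => (hh.iterate_deriv n).continuous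
  induction m with
  | zero =>
    simp only [pow_zero, one_mul]
    rw [intervalIntegral.integral_eq_sub_of_hasDerivAt (fun x _ => h_deriv 0 x)
      ((h_cont _).intervalIntegrable _ _), h_end]
    simp
  | succ m ih =>
    have h_pow : ∀ x, HasDerivAt (fun u => (u - v) ^ (m + 1)) ((m + 1 : ℕ) * (x - v) ^ m) x :=
      fun x => by simpa using ((hasDerivAt_id x).sub_const v).fun_pow (m + 1)
    rw [intervalIntegral.integral_mul_deriv_eq_deriv_mul (fun x _ => h_pow x)
      (fun x _ => h_deriv (m + 1) x) (Continuous.intervalIntegrable (by fun_prop) _ _)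
      ((h_cont _).intervalIntegrable _ _), h_end]
    simp only [mul_assoc, intervalIntegral.integral_const_mul, ih]
    rw [Nat.factorial_succ]
    push_cast
    simp
    ring

lemma integral_truncPow_mul_iterate_deriv {q : ℕ} (hq : 1 ≤ q) {h : ℝ → ℝ}
    (hh : ContDiff ℝ (⊤ : ℕ∞) h) (h_one : 1 ∉ tsupport h) {v : ℝ} (hv : v ∈ Icc (0 : ℝ) 1) :
    ∫ u, truncPow q v u * (deriv^[q] h) u ∂unitMeasure =
      (-1) ^ q * (q - 1).factorial * h v := by
  obtain ⟨m, rfl⟩ := Nat.exists_eq_add_of_le' hq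
  have h_indicator : (fun u => truncPow (m + 1) v u * (deriv^[m + 1] h) u) =
      (Ici v).indicator fun u => (u - v) ^ m * (deriv^[m + 1] h) u := by
    funext u
    simp only [truncPow, indicator_apply, mem_Ici, ite_mul, zero_mul, Nat.add_sub_cancel]
  have h_inter : Ici v ∩ Icc 0 1 = Icc v 1 := by
    ext u
    exact ⟨fun h => ⟨h.1, h.2.2⟩, fun h => ⟨h.1, hv.1.trans h.1, h.2⟩⟩
  rw [h_indicator, integral_indicator measurableSet_Ici,
    Measure.restrict_restrict measurableSet_Ici, h_inter, integral_Icc_eq_integral_Ioc,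
    ← intervalIntegral.integral_of_le hv.2, integral_sub_pow_mul_iterate_deriv hh h_one,
    Nat.add_sub_cancel]

end OneVariable

section MixedDerivatives

variable {d : ℕ} {φ ψ : (Fin d → ℝ) → ℝ}

lemma partialDeriv_eq_fderiv (k : Fin d) (h : ContDiff ℝ (⊤ : ℕ∞) φ) :
    partialDeriv k φ = fun u => fderiv ℝ φ u (Pi.single k 1) :=
  funext fun u => ((h.differentiable (by simp)) u).lineDeriv_eq_fderiv

lemma partialDeriv_add (k : Fin d) (hφ : ContDiff ℝ (⊤ : ℕ∞) φ) (hψ : ContDiff ℝ (⊤ : ℕ∞) ψ) :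
    partialDeriv k (φ + ψ) = partialDeriv k φ + partialDeriv k ψ := by
  have h_add : ContDiff ℝ (⊤ : ℕ∞) (φ + ψ) := hφ.add hψ
  rw [partialDeriv_eq_fderiv k hφ, partialDeriv_eq_fderiv k hψ, partialDeriv_eq_fderiv k h_add]
  funext u
  rw [fderiv_add (hφ.differentiable (by simp) u) (hψ.differentiable (by simp) u)]
  rfl

lemma partialDeriv_const_smul (k : Fin d) (c : ℝ) (φ : (Fin d → ℝ) → ℝ) :
    partialDeriv k (c • φ) = c • partialDeriv k φ :=
  funext fun _ => deriv_const_smul_field c _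

/-- The iterated partial derivative `∂_{k₁} ⋯ ∂_{kₙ} φ` along a list `[k₁, …, kₙ]` of coordinates.
It allows inductions over the single derivatives that make up `mixedDeriv`. -/
noncomputable def iteratedPartialDeriv (l : List (Fin d)) (φ : (Fin d → ℝ) → ℝ) : (Fin d → ℝ) → ℝ :=
  l.foldr partialDeriv φ

lemma iteratedPartialDeriv_append (l l' : List (Fin d)) (φ : (Fin d → ℝ) → ℝ) :
    iteratedPartialDeriv (l ++ l') φ = iteratedPartialDeriv l (iteratedPartialDeriv l' φ) :=
  List.foldr_append

lemma iteratedPartialDeriv_replicate (n : ℕ) (k : Fin d) (φ : (Fin d → ℝ) → ℝ) :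
    iteratedPartialDeriv (List.replicate n k) φ = (partialDeriv k)^[n] φ := by
  induction n with
  | zero => rfl
  | succ n ih => rw [Function.iterate_succ_apply', ← ih]; rfl

lemma mixedDeriv_eq_iteratedPartialDeriv (q : ℕ) (φ : (Fin d → ℝ) → ℝ) : mixedDeriv q d φ =
    iteratedPartialDeriv ((List.finRange d).flatMap (List.replicate q)) φ := by
  rw [mixedDeriv]
  induction List.finRange d with
  | nil => rfl
  | cons k l ih =>
    rw [List.foldr_cons, ih, List.flatMap_cons, iteratedPartialDeriv_append,
      iteratedPartialDeriv_replicate]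

lemma contDiff_iteratedPartialDeriv (l : List (Fin d)) (h : ContDiff ℝ (⊤ : ℕ∞) φ) :
    ContDiff ℝ (⊤ : ℕ∞) (iteratedPartialDeriv l φ) := by
  induction l with
  | nil => exact h
  | cons k l ih => exact contDiff_partialDeriv k ih

lemma tsupport_iteratedPartialDeriv_subset (l : List (Fin d)) (h : ContDiff ℝ (⊤ : ℕ∞) φ) :
    tsupport (iteratedPartialDeriv l φ) ⊆ tsupport φ := by
  induction l with
  | nil => exact subset_rfl
  | cons k l ih =>
    refine Subset.trans ?_ ih
    change tsupport (partialDeriv k (iteratedPartialDeriv l φ)) ⊆ _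
    rw [partialDeriv_eq_fderiv k (contDiff_iteratedPartialDeriv l h)]
    exact tsupport_fderiv_apply_subset ℝ _

lemma iteratedPartialDeriv_add (l : List (Fin d)) (hφ : ContDiff ℝ (⊤ : ℕ∞) φ)
    (hψ : ContDiff ℝ (⊤ : ℕ∞) ψ) : iteratedPartialDeriv l (φ + ψ) =
      iteratedPartialDeriv l φ + iteratedPartialDeriv l ψ := by
  induction l with
  | nil => rfl
  | cons k l ih =>
    exact (congrArg _ ih).trans (partialDeriv_add k (contDiff_iteratedPartialDeriv l hφ)
      (contDiff_iteratedPartialDeriv l hψ))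

lemma iteratedPartialDeriv_const_smul (l : List (Fin d)) (c : ℝ) (φ : (Fin d → ℝ) → ℝ) :
    iteratedPartialDeriv l (c • φ) = c • iteratedPartialDeriv l φ := by
  induction l with
  | nil => rfl
  | cons k l ih => exact (congrArg _ ih).trans (partialDeriv_const_smul k c _)

end MixedDerivatives

section Slices

variable {d : ℕ}

lemma partialDeriv_succ_cons (k : Fin d) (φ : (Fin (d + 1) → ℝ) → ℝ) (x : ℝ) (w : Fin d → ℝ) :
    partialDeriv k.succ φ (Fin.cons x w) = partialDeriv k (fun w => φ (Fin.cons x w)) w := by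
  have h_line : ∀ t : ℝ, (Fin.cons x w : Fin (d + 1) → ℝ) + t • Pi.single k.succ 1 =
      (Fin.cons x (w + t • Pi.single k 1) : Fin (d + 1) → ℝ) := fun t =>
    funext (Fin.cases (by simp) fun j => by simp [Pi.single_apply])
  simp only [partialDeriv, lineDeriv, h_line]

lemma partialDeriv_zero_cons (φ : (Fin (d + 1) → ℝ) → ℝ) (x : ℝ) (w : Fin d → ℝ) :
    partialDeriv 0 φ (Fin.cons x w) = deriv (fun x => φ (Fin.cons x w)) x := by
  have h_line : ∀ t : ℝ, (Fin.cons x w : Fin (d + 1) → ℝ) + t • Pi.single 0 1 =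
      (Fin.cons (x + t) w : Fin (d + 1) → ℝ) := fun t =>
    funext (Fin.cases (by simp) fun j => by simp)
  simp only [partialDeriv, lineDeriv, h_line]
  rw [deriv_comp_const_add (f := fun y => φ (Fin.cons y w)), add_zero]

lemma iteratedPartialDeriv_map_succ_cons (l : List (Fin d)) (φ : (Fin (d + 1) → ℝ) → ℝ) (x : ℝ) :
    (fun w => iteratedPartialDeriv (l.map Fin.succ) φ (Fin.cons x w)) =
      iteratedPartialDeriv l fun w => φ (Fin.cons x w) := by
  induction l with
  | nil => rfl
  | cons k l ih =>
    exact (funext fun w => partialDeriv_succ_cons k _ x w).trans (congrArg (partialDeriv k) ih)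

lemma iterate_partialDeriv_zero_cons (n : ℕ) (φ : (Fin (d + 1) → ℝ) → ℝ) (w : Fin d → ℝ) :
    (fun x => ((partialDeriv 0)^[n] φ) (Fin.cons x w)) = deriv^[n] fun x => φ (Fin.cons x w) := by
  have h_semiconj : Function.Semiconj
      (fun (φ : (Fin (d + 1) → ℝ) → ℝ) (x : ℝ) => φ (Fin.cons x w)) (partialDeriv 0) deriv :=
    fun φ => funext fun x => partialDeriv_zero_cons φ x w
  exact h_semiconj.iterate_right n φ

/-- The partial derivatives of order `q` in all coordinates but the first. -/
noncomputable def mixedDerivTail (q : ℕ) (φ : (Fin (d + 1) → ℝ) → ℝ) : (Fin (d + 1) → ℝ) → ℝ :=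
  iteratedPartialDeriv (((List.finRange d).flatMap (List.replicate q)).map Fin.succ) φ

lemma mixedDerivTail_cons (q : ℕ) (φ : (Fin (d + 1) → ℝ) → ℝ) (x : ℝ) (w : Fin d → ℝ) :
    mixedDerivTail q φ (Fin.cons x w) = mixedDeriv q d (fun w => φ (Fin.cons x w)) w := by
  rw [mixedDeriv_eq_iteratedPartialDeriv, ← iteratedPartialDeriv_map_succ_cons, mixedDerivTail]

lemma mixedDeriv_succ_cons (q : ℕ) (φ : (Fin (d + 1) → ℝ) → ℝ) (x : ℝ) (w : Fin d → ℝ) :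
    mixedDeriv q (d + 1) φ (Fin.cons x w) =
      (deriv^[q] fun x => mixedDerivTail q φ (Fin.cons x w)) x := by
  rw [← iterate_partialDeriv_zero_cons, mixedDeriv_eq_iteratedPartialDeriv, List.finRange_succ,
    List.flatMap_cons, iteratedPartialDeriv_append, iteratedPartialDeriv_replicate,
    List.flatMap_map, mixedDerivTail, List.map_flatMap]
  simp only [List.map_replicate]

lemma contDiff_cons_left (w : Fin d → ℝ) :
    ContDiff ℝ (⊤ : ℕ∞) fun x : ℝ => (Fin.cons x w : Fin (d + 1) → ℝ) :=
  contDiff_pi.2 (Fin.cases (by simpa using contDiff_fun_id) fun j => by simpa using contDiff_const)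

lemma contDiff_cons_right (x : ℝ) :
    ContDiff ℝ (⊤ : ℕ∞) fun w : Fin d → ℝ => (Fin.cons x w : Fin (d + 1) → ℝ) :=
  contDiff_pi.2
    (Fin.cases (by simpa using contDiff_const) fun j => by simpa using contDiff_apply ℝ ℝ j)

lemma integral_cubeMeasure_succ {f : (Fin (d + 1) → ℝ) → ℝ}
    (hf : Integrable f (cubeMeasure (d + 1))) : ∫ u, f u ∂cubeMeasure (d + 1) =
      ∫ w, ∫ x, f (Fin.cons x w) ∂unitMeasure ∂cubeMeasure d := by
  set T := (MeasurableEquiv.piFinSuccAbove (fun _ : Fin (d + 1) => ℝ) 0).symm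
  have hT : MeasurePreserving T (unitMeasure.prod (cubeMeasure d)) (cubeMeasure (d + 1)) :=
    (measurePreserving_piFinSuccAbove (fun _ : Fin (d + 1) => unitMeasure) 0).symm
  have hT_apply : ∀ z, T z = (Fin.cons z.1 z.2 : Fin (d + 1) → ℝ) := fun z =>
    Fin.insertNth_zero' z.1 z.2
  have h_fubini := integral_prod_symm _ ((hT.integrable_comp_emb T.measurableEmbedding).2 hf)
  simp only [Function.comp_apply, hT_apply] at h_fubini
  simp only [← h_fubini, ← hT.integral_comp T.measurableEmbedding, hT_apply]

end Slices

section FundamentalSolution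

variable {q d : ℕ}

lemma memLp_cubeMeasure_of_continuous {f : (Fin d → ℝ) → ℝ} (hf : Continuous f) (p : ℝ≥0∞) :
    MemLp f p (cubeMeasure d) := by
  have hK : IsCompact (Set.pi univ fun _ : Fin d => Icc (0 : ℝ) 1) :=
    isCompact_univ_pi fun _ => isCompact_Icc
  obtain ⟨C, hC⟩ := hK.exists_bound_of_continuousOn hf.continuousOn
  refine MemLp.of_bound hf.aestronglyMeasurable C ?_
  rw [cubeMeasure, ← Measure.restrict_pi_pi]
  exact ae_restrict_of_forall_mem hK.measurableSet hC

lemma integrable_tensorPow_mul_mixedDeriv (q : ℕ) (v : Fin d → ℝ) {φ : (Fin d → ℝ) → ℝ}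
    (hφ : ContDiff ℝ (⊤ : ℕ∞) φ) :
    Integrable (fun u => tensorPow q v u * mixedDeriv q d φ u) (cubeMeasure d) :=
  ((Lp.memLp (tensorPowL2 q v)).ae_eq (coeFn_tensorPowL2 q v)).integrable_mul
    (memLp_cubeMeasure_of_continuous (contDiff_mixedDeriv q d hφ).continuous 2)

lemma integral_tensorPow_mul_mixedDeriv_cons (hq : 1 ≤ q) {φ : (Fin (d + 1) → ℝ) → ℝ}
    (hφ : ContDiff ℝ (⊤ : ℕ∞) φ) (hs : tsupport φ ⊆ openCube (d + 1)) {v : Fin (d + 1) → ℝ}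
    (hv : v 0 ∈ Icc (0 : ℝ) 1) (w : Fin d → ℝ) :
    ∫ x, tensorPow q v (Fin.cons x w) * mixedDeriv q (d + 1) φ (Fin.cons x w) ∂unitMeasure =
      (-1) ^ q * (q - 1).factorial *
        (tensorPow q (Fin.tail v) w * mixedDeriv q d (fun w => φ (Fin.cons (v 0) w)) w) := by
  set g := fun x : ℝ => mixedDerivTail q φ (Fin.cons x w)
  have h_smooth : ContDiff ℝ (⊤ : ℕ∞) g :=
    (contDiff_iteratedPartialDeriv _ hφ).comp (contDiff_cons_left w)
  have h_one : 1 ∉ tsupport g := fun h => by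
    have h_mem := hs (tsupport_iteratedPartialDeriv_subset _ hφ
      (tsupport_comp_subset_preimage _ (contDiff_cons_left w).continuous h))
    exact lt_irrefl (1 : ℝ) (h_mem 0 (mem_univ _)).2
  have h_factor : ∀ x, tensorPow q v (Fin.cons x w) * mixedDeriv q (d + 1) φ (Fin.cons x w) =
      tensorPow q (Fin.tail v) w * (truncPow q (v 0) x * (deriv^[q] g) x) := fun x => by
    rw [mixedDeriv_succ_cons, tensorPow, Fin.prod_univ_succ]
    simp only [Fin.cons_zero, Fin.cons_succ, tensorPow, Fin.tail]
    ring
  simp only [h_factor]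
  rw [integral_const_mul, integral_truncPow_mul_iterate_deriv hq h_smooth h_one hv,
    ← mixedDerivTail_cons]
  ring

lemma integral_tensorPow_mul_mixedDeriv (hq : 1 ≤ q) {φ : (Fin d → ℝ) → ℝ}
    (hφ : ContDiff ℝ (⊤ : ℕ∞) φ) (hs : tsupport φ ⊆ openCube d) {v : Fin d → ℝ}
    (hv : v ∈ Icc 0 1) :
    ∫ u, tensorPow q v u * mixedDeriv q d φ u ∂cubeMeasure d =
      ((-1) ^ q * (q - 1).factorial) ^ d * φ v := by
  induction d with
  | zero =>
    rw [integral_unique]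
    simp only [tensorPow, mixedDeriv, Finset.univ_eq_empty, Finset.prod_empty, one_mul, pow_zero,
      List.finRange_zero, List.foldr_nil, probReal_univ, smul_eq_mul]
    exact congrArg φ (Subsingleton.elim _ _)
  | succ d ih =>
    have h_slice : tsupport (fun w => φ (Fin.cons (v 0) w)) ⊆ openCube d := fun w hw k _ => by
      have h_mem := hs (tsupport_comp_subset_preimage φ (contDiff_cons_right (v 0)).continuous hw)
      exact h_mem k.succ (mem_univ _)
    rw [integral_cubeMeasure_succ (integrable_tensorPow_mul_mixedDeriv q v hφ)]
    simp only [integral_tensorPow_mul_mixedDeriv_cons hq hφ hs ⟨hv.1 0, hv.2 0⟩]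
    rw [integral_const_mul, ih (φ := fun w => φ (Fin.cons (v 0) w)) (v := Fin.tail v)
      (hφ.comp (contDiff_cons_right (v 0))) h_slice
      ⟨fun k => hv.1 k.succ, fun k => hv.2 k.succ⟩, Fin.cons_self_tail, pow_succ]
    ring

end FundamentalSolution

section Polar

variable {H : Type*} [NormedAddCommGroup H] [InnerProductSpace ℝ H]

lemma inner_starProjection_of_mem {K : Submodule ℝ H} [K.HasOrthogonalProjection] {x : H}
    (hx : x ∈ K) (y : H) : inner ℝ x (K.starProjection y) = inner ℝ x y := by
  rw [← Submodule.inner_starProjection_left_eq_right, Submodule.starProjection_eq_self_iff.2 hx]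

lemma forall_mem_closedAbsConvexHull_inner_le_iff {S : Set H} {w : H} {c : ℝ} :
    (∀ x ∈ closedAbsConvexHull ℝ S, inner ℝ w x ≤ c) ↔ ∀ x ∈ S, |inner ℝ w x| ≤ c := by
  constructor
  · intro h x hx
    have hx_hull := subset_closedAbsConvexHull (𝕜 := ℝ) hx
    have h_neg := h (-x) (absConvex_convexClosedHull.1.neg_mem_iff.2 hx_hull)
    rw [inner_neg_right] at h_neg
    exact abs_le'.2 ⟨h x hx_hull, h_neg⟩
  · intro h x hx
    have h_absConvex : AbsConvex ℝ {x : H | |inner ℝ w x| ≤ c} := by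
      set p : Seminorm ℝ H := (innerSL ℝ w : H →ₗ[ℝ] ℝ).toSeminorm
      have h_ball : {x : H | |inner ℝ w x| ≤ c} = p.closedBall 0 c :=
        Set.ext fun x => p.mem_closedBall_zero.symm
      rw [h_ball]
      exact ⟨p.balanced_closedBall_zero c, p.convex_closedBall 0 c⟩
    have h_closed : IsClosed {x : H | |inner ℝ w x| ≤ c} :=
      isClosed_le (by fun_prop) continuous_const
    exact (le_abs_self _).trans (closedAbsConvexHull_min h h_absConvex h_closed hx)

lemma exists_mem_separating_of_notMem_image_starProjection [CompleteSpace H] {K : Submodule ℝ H}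
    [K.HasOrthogonalProjection] {T : Set H} (hT : IsCompact T) (hconv : Convex ℝ T) {f : H}
    (hf : f ∈ K) (hfT : f ∉ K.starProjection '' T) :
    ∃ g ∈ K, ∃ t : ℝ, (∀ x ∈ T, inner ℝ g x < t) ∧ t < inner ℝ g f := by
  obtain ⟨F, t, hFt, htF⟩ := geometric_hahn_banach_closed_point
    (hconv.linear_image (K.starProjection : H →ₗ[ℝ] H))
    (hT.image K.starProjection.continuous).isClosed hfT
  set g := K.starProjection ((InnerProductSpace.toDual ℝ H).symm F)
  have h_inner : ∀ x, inner ℝ g x = F (K.starProjection x) := fun x => by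
    rw [Submodule.inner_starProjection_left_eq_right, InnerProductSpace.toDual_symm_apply]
  refine ⟨g, Submodule.starProjection_apply_mem _ _, t, fun x hx => ?_, ?_⟩
  · rw [h_inner]
    exact hFt _ (mem_image_of_mem _ hx)
  · rwa [h_inner, Submodule.starProjection_eq_self_iff.2 hf]

lemma exists_mem_separating_of_mem_closure {W : Submodule ℝ H} {T : Set H}
    (hT : Bornology.IsBounded T) (h_zero : 0 ∈ T) {f g : H} {t c : ℝ} (hc : 0 < c)
    (hg : g ∈ closure (W : Set H)) (h_lt : ∀ x ∈ T, inner ℝ g x < t) (hf : t < inner ℝ g f) :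
    ∃ w ∈ W, (∀ x ∈ T, inner ℝ w x ≤ c) ∧ c < inner ℝ w f := by
  obtain ⟨C, hC_pos, hC⟩ := (hT.insert f).exists_pos_norm_le
  obtain ⟨w, hw, h_dist⟩ := Metric.mem_closure_iff.1 hg ((inner ℝ g f - t) / 2 / C)
    (div_pos (half_pos (sub_pos.2 hf)) hC_pos)
  rw [dist_eq_norm, lt_div_iff₀ hC_pos] at h_dist
  have h_close : ∀ x ∈ insert f T, |inner ℝ g x - inner ℝ w x| < (inner ℝ g f - t) / 2 := by
    intro x hx
    rw [← inner_sub_left]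
    calc |inner ℝ (g - w) x| ≤ ‖g - w‖ * ‖x‖ := abs_real_inner_le_norm _ _
      _ ≤ ‖g - w‖ * C := by gcongr; exact hC x hx
      _ < (inner ℝ g f - t) / 2 := h_dist
  have ht : 0 < t := by simpa only [inner_zero_right] using h_lt 0 h_zero
  obtain ⟨s, hs_eq⟩ : ∃ s, s = (inner ℝ g f + t) / 2 := ⟨_, rfl⟩
  have hs : 0 < s := by linarith
  have h_scale : ∀ x, inner ℝ ((c / s) • w) x = c * inner ℝ w x / s := fun x => by
    rw [real_inner_smul_left, div_mul_eq_mul_div]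
  refine ⟨(c / s) • w, W.smul_mem _ hw, fun x hx => ?_, ?_⟩
  · have h_le : inner ℝ w x ≤ s := by
      linarith [h_lt x hx, (abs_lt.1 (h_close x (mem_insert_of_mem f hx))).1]
    rw [h_scale, div_le_iff₀ hs]
    gcongr
  · have h_gt : s < inner ℝ w f := by linarith [(abs_lt.1 (h_close f (mem_insert f T))).2]
    rw [h_scale, lt_div_iff₀ hs]
    gcongr

/- A form of the bipolar theorem. Compactness of `T` makes its image closed, so that an element of
`Wᗮᗮ` outside the image can be separated from it by a functional in the closure of `W`, hence by
one in `W`. -/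
theorem image_starProjection_orthogonal_orthogonal [CompleteSpace H] (W : Submodule ℝ H)
    {T : Set H} (hT : IsCompact T) (hconv : Convex ℝ T) (h_zero : 0 ∈ T) {c : ℝ} (hc : 0 < c) :
    Wᗮᗮ.starProjection '' T =
      {f ∈ Wᗮᗮ | ∀ w ∈ W, (∀ x ∈ T, inner ℝ w x ≤ c) → inner ℝ w f ≤ c} := by
  refine Subset.antisymm ?_ fun f ⟨hf, hfW⟩ => ?_
  · rintro _ ⟨x, hx, rfl⟩
    refine ⟨Submodule.starProjection_apply_mem _ _, fun w hw hwT => ?_⟩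
    rw [inner_starProjection_of_mem (W.le_orthogonal_orthogonal hw)]
    exact hwT x hx
  · by_contra hfT
    obtain ⟨g, hg, t, hgT, hgf⟩ :=
      exists_mem_separating_of_notMem_image_starProjection hT hconv hf hfT
    rw [Submodule.orthogonal_orthogonal_eq_closure] at hg
    obtain ⟨w, hw, hwT, hwf⟩ :=
      exists_mem_separating_of_mem_closure hT.isBounded h_zero hc hg hgT hgf
    exact (hfW w hw hwT).not_gt hwf

end Polar

section Duality

variable {q d : ℕ}

/-- The operator `D` on test functions, with values in `L²`. Its range `W` gives
`nullSpace q d = Wᗮ`. -/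
noncomputable def mixedDerivL2 (q d : ℕ) : 𝓓(openCube d, ℝ) →ₗ[ℝ] L2Cube d where
  toFun φ :=
    (memLp_cubeMeasure_of_continuous (contDiff_mixedDeriv q d φ.contDiff).continuous 2).toLp _
  map_add' φ ψ := by
    rw [← MemLp.toLp_add]
    congr 1
    simp only [mixedDeriv_eq_iteratedPartialDeriv]
    exact iteratedPartialDeriv_add _ φ.contDiff ψ.contDiff
  map_smul' c φ := by
    rw [RingHom.id_apply, ← MemLp.toLp_const_smul]
    congr 1
    simp only [mixedDeriv_eq_iteratedPartialDeriv]
    exact iteratedPartialDeriv_const_smul _ c φ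

lemma coeFn_mixedDerivL2 (q : ℕ) (φ : 𝓓(openCube d, ℝ)) :
    mixedDerivL2 q d φ =ᵐ[cubeMeasure d] mixedDeriv q d φ :=
  (memLp_cubeMeasure_of_continuous (contDiff_mixedDeriv q d φ.contDiff).continuous 2).coeFn_toLp

lemma inner_mixedDerivL2 (q : ℕ) (φ : 𝓓(openCube d, ℝ)) (f : L2Cube d) :
    inner ℝ (mixedDerivL2 q d φ) f = ∫ u, f u * mixedDeriv q d φ u ∂cubeMeasure d := by
  rw [L2.inner_def]
  refine integral_congr_ae ?_
  filter_upwards [coeFn_mixedDerivL2 q φ] with u hu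
  rw [hu, RCLike.inner_apply, conj_trivial]

lemma nullSpace_eq (q d : ℕ) : nullSpace q d = (LinearMap.range (mixedDerivL2 q d))ᗮ := by
  ext f
  simp only [Submodule.mem_orthogonal, LinearMap.mem_range, forall_exists_index,
    forall_apply_eq_imp_iff, inner_mixedDerivL2]
  rfl

lemma vitaliVariation_le_iff {f : L2Cube d} {r : ℝ} (hr : 0 ≤ r) :
    vitaliVariation q f ≤ ENNReal.ofReal r ↔ ∀ φ : 𝓓(openCube d, ℝ), (∀ u, |φ u| ≤ 1) →
      inner ℝ (mixedDerivL2 q d φ) f ≤ r := by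
  simp only [vitaliVariation, iSup_le_iff, ← inner_mixedDerivL2, ENNReal.ofReal_le_ofReal_iff hr]

lemma abs_inner_mixedDerivL2_tensorPowL2 (hq : 1 ≤ q) (φ : 𝓓(openCube d, ℝ)) {v : Fin d → ℝ}
    (hv : v ∈ Icc 0 1) : |inner ℝ (mixedDerivL2 q d φ) (tensorPowL2 q v)| =
      ((q - 1).factorial : ℝ) ^ d * |φ v| := by
  have h_integral : inner ℝ (mixedDerivL2 q d φ) (tensorPowL2 q v) =
      ((-1) ^ q * (q - 1).factorial) ^ d * φ v := by
    rw [inner_mixedDerivL2, ← integral_tensorPow_mul_mixedDeriv hq φ.contDiff φ.tsupport_subset hv]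
    refine integral_congr_ae ?_
    filter_upwards [coeFn_tensorPowL2 q v] with u hu
    rw [hu]
  rw [h_integral, abs_mul, abs_pow, abs_mul, abs_pow, abs_neg, abs_one, one_pow, one_mul,
    Nat.abs_cast]

lemma testFunction_eq_zero_of_notMem_Icc (φ : 𝓓(openCube d, ℝ)) {u : Fin d → ℝ}
    (hu : u ∉ Icc 0 1) : φ u = 0 :=
  image_eq_zero_of_notMem_tsupport fun hc => hu
    ⟨fun k => (φ.tsupport_subset hc k (mem_univ k)).1.le,
      fun k => (φ.tsupport_subset hc k (mem_univ k)).2.le⟩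

lemma absconvTensor_eq_closedAbsConvexHull (q d : ℕ) :
    absconvTensor q d = closedAbsConvexHull ℝ (tensorPowL2 q '' Icc (0 : Fin d → ℝ) 1) := by
  rw [absconvTensor_eq, closedAbsConvexHull_eq_closure_absConvexHull]

lemma forall_mem_absconvTensor_inner_mixedDerivL2_le_iff (hq : 1 ≤ q) (φ : 𝓓(openCube d, ℝ)) :
    (∀ x ∈ absconvTensor q d, inner ℝ (mixedDerivL2 q d φ) x ≤ ((q - 1).factorial : ℝ) ^ d) ↔
      ∀ u, |φ u| ≤ 1 := by
  have h_factorial : (0 : ℝ) < ((q - 1).factorial : ℝ) ^ d := by positivity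
  rw [absconvTensor_eq_closedAbsConvexHull, forall_mem_closedAbsConvexHull_inner_le_iff,
    forall_mem_image]
  constructor
  · intro h u
    by_cases hu : u ∈ Icc 0 1
    · have h_le := h hu
      rwa [abs_inner_mixedDerivL2_tensorPowL2 hq φ hu, mul_le_iff_le_one_right h_factorial] at h_le
    · rw [testFunction_eq_zero_of_notMem_Icc φ hu, abs_zero]
      exact zero_le_one
  · intro h u hu
    rw [abs_inner_mixedDerivL2_tensorPowL2 hq φ hu]
    exact mul_le_of_le_one_right h_factorial.le (h u)

theorem image_starProjection_absconvTensor (hq : 1 ≤ q) (d : ℕ) :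
    (nullSpace q d)ᗮ.starProjection '' absconvTensor q d =
      vitaliBall q d (((q - 1).factorial : ℝ≥0∞) ^ d) := by
  have h_compact : IsCompact (absconvTensor q d) := by
    rw [absconvTensor_eq_closedAbsConvexHull]
    exact isCompact_closedAbsConvexHull_of_totallyBounded
      (isCompact_Icc.image_of_continuousOn (continuousOn_tensorPowL2 hq d)).totallyBounded
  have h_absConvex : AbsConvex ℝ (absconvTensor q d) := by
    rw [absconvTensor_eq_closedAbsConvexHull]
    exact absConvex_convexClosedHull
  have h_zero : (0 : L2Cube d) ∈ absconvTensor q d := by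
    rw [absconvTensor_eq_closedAbsConvexHull] at h_absConvex ⊢
    exact h_absConvex.1.zero_mem
      (((nonempty_Icc.2 zero_le_one).image _).mono subset_closedAbsConvexHull)
  have h_factorial : (0 : ℝ) < ((q - 1).factorial : ℝ) ^ d := by positivity
  have h_ofReal : ENNReal.ofReal (((q - 1).factorial : ℝ) ^ d) =
      ((q - 1).factorial : ℝ≥0∞) ^ d := by
    rw [ENNReal.ofReal_pow (Nat.cast_nonneg _), ENNReal.ofReal_natCast]
  ext f
  simp only [nullSpace_eq, image_starProjection_orthogonal_orthogonal _ h_compact h_absConvex.2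
    h_zero h_factorial, vitaliBall, ← h_ofReal, vitaliVariation_le_iff h_factorial.le,
    mem_ofPred_eq, LinearMap.mem_range, forall_exists_index, forall_apply_eq_imp_iff,
    forall_mem_absconvTensor_inner_mixedDerivL2_le_iff hq]

end Duality

end MARS

theorem mainTheorem5 (q d : ℕ) (hq : 1 ≤ q) (hd : 1 ≤ d) :
    -- covering numbers of the truncated power functions
    (2 ≤ q → ∃ C : ℝ, ∀ᶠ ε : ℝ in 𝓝[>] 0,
      (Metric.coveringNumber ε.toNNReal (MARS.truncPowClass q) : ℝ≥0∞) ≤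
        ENNReal.ofReal (C * (1 / ε))) ∧
    (q = 1 → ∃ C : ℝ, ∀ᶠ ε : ℝ in 𝓝[>] 0,
      (Metric.coveringNumber ε.toNNReal (MARS.truncPowClass q) : ℝ≥0∞) ≤
        ENNReal.ofReal (C * (1 / ε) ^ 2)) ∧
    -- entropy of the absolute convex hull of the tensors
    (∃ C : ℝ, ∀ᶠ ε : ℝ in 𝓝[>] 0,
      MARS.entropy ε.toNNReal (MARS.absconvTensor q d) ≤
        ((C * (ε ^ (-(1 / (q : ℝ))) * Real.log (1 / ε) ^ (d - 1) *
          Real.log (1 / ε) ^ (1 / (2 * (q : ℝ)))) : ℝ) : EReal)) ∧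
    -- the orthogonal components of the hull are the ball of the Vitali total variation
    (MARS.nullSpace q d)ᗮ.starProjection '' MARS.absconvTensor q d =
      MARS.vitaliBall q d ((Nat.factorial (q - 1) : ℝ≥0∞) ^ d) ∧
    -- entropy of the class of functions of Vitali total variation at most one
    (∃ C : ℝ, ∀ᶠ ε : ℝ in 𝓝[>] 0,
      MARS.entropy ε.toNNReal (MARS.vitaliBall q d 1) ≤
        ((C * (ε ^ (-(1 / (q : ℝ))) * Real.log (1 / ε) ^ (d - 1) *
          Real.log (1 / ε) ^ (1 / (2 * (q : ℝ)))) : ℝ) : EReal)) := by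
  have hcov := MARS.hasDyadicCovers_absconvTensor hq hd
  have himg := MARS.image_starProjection_absconvTensor hq d
  refine ⟨MARS.coveringNumber_truncPowClass_of_two_le, ?_, hcov.entropy_le hq, himg, ?_⟩
  · rintro rfl
    exact MARS.coveringNumber_truncPowClass_one
  · refine ((hcov.image (MARS.nullSpace q d)ᗮ.lipschitzWith_starProjection).mono ?_).entropy_le hq
    rw [himg]
    rintro f ⟨hf, hf_le⟩
    refine ⟨hf, hf_le.trans (one_le_pow₀ ?_)⟩
    exact_mod_cast Nat.one_le_iff_ne_zero.2 (Nat.factorial_ne_zero (q - 1))
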